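/- **Theorem 3.2 (regular case).** Let $X_1,X_2$ be complex separable Hilbert spaces, let $A_1,A_2$ generate $C_0$-semigroups $S_1(t),S_2(t)$ on $X_1,X_2$, and let $b_1\in X_1$, $b_2,c\in X_2$, $t_1>0$. The inner product $(\cdot,\cdot)$ is taken linear in its second argument. Let $(\lambda_j)_{j\in J}$ be pairwise distinct eigenvalues of $A_1$ without finite limit point, with eigenvectors $\varphi_j$ that form a Riesz basis of $X_1$, and let $\psi_j$ be the eigenvectors of $A_1^*$, $A_1^*\psi_j=\bar\lambda_j\psi_j$, with $(\psi_i,\varphi_j)=\delta_{ij}$. Put $b_{1j}=(\psi_j,b_1)$, and if $\lambda_j=0$ for some $j$, assume $b_{1j}\neq 0$ for that $j$. Consider the interconnected system $$\dot x_1=A_1x_1+b_1v,\quad x_1(0)=x_1^0,\qquad v(t)=(c,x_2(t)),\qquad \dot x_2=A_2x_2+b_2u,\quad x_2(0)=x_2^0,$$ with mild solutions $x_1(t)=S_1(t)x_1^0+\int_0^tS_1(t-\tau)b_1v(\tau)\,d\tau$ and $x_2(t)=S_2(t)x_2^0+\int_0^tS_2(t-\tau)b_2u(\tau)\,d\tau$.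 Assume that * the family $\{1\}\cup\{\tfrac{b_{1j}}{\lambda_j}e^{-\lambda_jt}:\lambda_j\ne0\}$ is strongly minimal in $L^2[0,t_1]$, where a family $(g_i)$ is strongly minimal if there is $\gamma>0$ with $\gamma\sum|a_i|^2\le\|\sum a_ig_i\|^2$ for all finite linear combinations; * $c\in D(A_2^*)$ and $(c,b_2)\neq0$. Then the interconnected system is exactly null-controllable on $[0,t_1]$: for all $x_1^0\in X_1$, $x_2^0\in X_2$ there is $u\in L^2[0,t_1]$ with $x_1(t_1)=0$. Moreover, let $x_1^0\in X_1$ and $x_2^0\in X_2$. There is an absolutely continuous $v$ on $[0,t_1]$ with $v'\in L^2[0,t_1]$, $v(0)=(c,x_2^0)$, $v(t_1)=0$ that steers the first equation to $x_1(t_1)=0$. For every such $v$ the Volterra equation of the second kind $$v(t)-(c,S_2(t)x_2^0)=(c,b_2)\,U(t)+\int_0^t\bigl(S_2^*(t-\tau)A_2^*c,\,b_2\bigr)U(\tau)\,d\tau,\qquad t\in[0,t_1],$$ has a unique continuous solution $U$ on $[0,t_1]$; it is absolutely continuous with $U(0)=0$, its derivative $u=U'$ (a.e.) belongs to $L^2[0,t_1]$,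 and with this control $(c,x_2(t))=v(t)$ on $[0,t_1]$ and $x_1(t_1)=0$. -/

import Mathlib

open MeasureTheory Set Filter Topology

/-- A strongly continuous one-parameter semigroup of bounded operators on `X`. Only the values at
times `t ≥ 0` are meaningful. -/
structure C0Semigroup (X : Type*) [NormedAddCommGroup X] [NormedSpace ℂ X] where
  /-- the operator at time `t` -/
  op : ℝ → X →L[ℂ] X
  op_zero : op 0 = ContinuousLinearMap.id ℂ X
  op_add : ∀ s t : ℝ, 0 ≤ s → 0 ≤ t → op (s + t) = (op s).comp (op t)
  continuousOn_orbit : ∀ x : X, ContinuousOn (fun t : ℝ => op t x) (Ici 0)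

/-- `A` is the infinitesimal generator of `S`: `x ∈ D(A)` and `A x = y` if and only if
`(S(h) x - x) / h → y` as `h → 0+`. -/
def C0Semigroup.HasGenerator {X : Type*} [NormedAddCommGroup X] [NormedSpace ℂ X]
    (S : C0Semigroup X) (A : X →ₗ.[ℂ] X) : Prop :=
  ∀ x y : X, (x, y) ∈ A.graph ↔
    Tendsto (fun h : ℝ => ((h : ℂ)⁻¹) • (S.op h x - x)) (𝓝[>] 0) (𝓝 y)

/-- A family is a Riesz basis of `X`: its span is dense and it satisfies two-sided `ℓ²` bounds. -/
def IsRieszBasis {J X : Type*} [NormedAddCommGroup X] [NormedSpace ℂ X] (φ : J → X) : Prop :=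
  closure (Submodule.span ℂ (range φ) : Set X) = univ ∧
  ∃ m M : ℝ, 0 < m ∧ 0 < M ∧ ∀ (s : Finset J) (a : J → ℂ),
    m * ∑ j ∈ s, ‖a j‖ ^ 2 ≤ ‖∑ j ∈ s, a j • φ j‖ ^ 2 ∧
    ‖∑ j ∈ s, a j • φ j‖ ^ 2 ≤ M * ∑ j ∈ s, ‖a j‖ ^ 2

/-- A family is strongly minimal: for some `γ > 0`, every finite linear combination satisfies
`γ ∑ |a_i|² ≤ ‖∑ a_i x_i‖²`. -/
def StronglyMinimal {I E : Type*} [NormedAddCommGroup E] [NormedSpace ℂ E] (x : I → E) : Prop :=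
  ∃ γ : ℝ, 0 < γ ∧ ∀ (s : Finset I) (a : I → ℂ),
    γ * ∑ i ∈ s, ‖a i‖ ^ 2 ≤ ‖∑ i ∈ s, a i • x i‖ ^ 2

/-- Lebesgue measure on `[0, T]`. -/
noncomputable abbrev volIcc (T : ℝ) : Measure ℝ := volume.restrict (Icc 0 T)

theorem memLp_mul_exp (T : ℝ) (k lam : ℂ) :
    MemLp (fun t : ℝ => k * Complex.exp (-lam * (t : ℂ))) 2 (volIcc T) := by
  have hc : Continuous (fun t : ℝ => k * Complex.exp (-lam * (t : ℂ))) := by fun_prop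
  obtain ⟨C, hC⟩ := isCompact_Icc.exists_bound_of_continuousOn (s := Icc (0 : ℝ) T) hc.continuousOn
  exact MemLp.of_bound hc.aestronglyMeasurable C
    ((ae_restrict_iff' measurableSet_Icc).2 (Eventually.of_forall hC))

/-- The function `t ↦ k e^{-λ t}` as an element of `L²[0, T]`. -/
noncomputable def expL2 (T : ℝ) (k lam : ℂ) : Lp ℂ 2 (volIcc T) :=
  (memLp_mul_exp T k lam).toLp _

/-- The family `{1} ∪ {(β j / λ j) e^{-λ j t} : λ j ≠ 0}` in `L²[0, T]`; the constant `1` has the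
index `none`. -/
noncomputable def augmentedExponentials {J : Type*} (T : ℝ) (lam β : J → ℂ) :
    Option {j : J // lam j ≠ 0} → Lp ℂ 2 (volIcc T)
  | none => expL2 T 1 0
  | some j => expL2 T (β j / lam j) (lam j)

/-- The mild solution `x(t) = S(t) x⁰ + ∫₀ᵗ S(t - τ) b v(τ) dτ` of `x' = A x + b v`,
`x(0) = x⁰`, where `A` generates `S`. -/
noncomputable def mildSolution {X : Type*} [NormedAddCommGroup X] [NormedSpace ℂ X]
    (S : C0Semigroup X) (b x0 : X) (v : ℝ → ℂ) (t : ℝ) : X :=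
  S.op t x0 + ∫ τ in (0 : ℝ)..t, v τ • S.op (t - τ) b

/-- The output `(c, x₂(t))` of the second equation under the control `u`. -/
noncomputable def outputSignal {X₂ : Type*} [NormedAddCommGroup X₂] [InnerProductSpace ℂ X₂]
    (S₂ : C0Semigroup X₂) (b₂ c x20 : X₂) (u : ℝ → ℂ) (t : ℝ) : ℂ :=
  inner ℂ c (mildSolution S₂ b₂ x20 u t)

/-- The interconnected system is exactly null-controllable on `[0, T]`: for all initial states
there is `u ∈ L²[0, T]` such that the first state, driven by `v = (c, x₂)`, vanishes at `T`. -/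
def ExactlyNullControllable {X₁ X₂ : Type*} [NormedAddCommGroup X₁] [NormedSpace ℂ X₁]
    [NormedAddCommGroup X₂] [InnerProductSpace ℂ X₂]
    (S₁ : C0Semigroup X₁) (b₁ : X₁) (S₂ : C0Semigroup X₂) (b₂ c : X₂) (T : ℝ) : Prop :=
  ∀ (x10 : X₁) (x20 : X₂), ∃ u : ℝ → ℂ, MemLp u 2 (volIcc T) ∧
    mildSolution S₁ b₁ x10 (outputSignal S₂ b₂ c x20 u) T = 0

/-- `v` is absolutely continuous on `[0, T]` with `v' ∈ L²[0, T]`, `v(0) = α`, `v(T) = β`. -/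
structure MemH1 (T : ℝ) (α β : ℂ) (v : ℝ → ℂ) : Prop where
  absCont : AbsolutelyContinuousOnInterval v 0 T
  deriv_memLp : MemLp (deriv v) 2 (volIcc T)
  left_eq : v 0 = α
  right_eq : v T = β

/-- `U` solves on `[0, T]` the Volterra equation of the second kind
`w(t) = κ U(t) + ∫₀ᵗ K(t - τ) U(τ) dτ`. -/
def SolvesVolterra (T : ℝ) (κ : ℂ) (K w U : ℝ → ℂ) : Prop :=
  ∀ t ∈ Icc (0 : ℝ) T, w t = κ * U t + ∫ τ in (0 : ℝ)..t, K (t - τ) * U τ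

/-! The two equations are treated separately: the first is steered to zero by an `H¹` signal `v`
with prescribed end values, and then a control `u` of the second equation is found whose output is
exactly `v`.

Pairing the first equation with `ψ j` turns `x₁(T) = 0` into a moment problem. Writing `v = α + ∫ w`
with `v(T) = 0` and integrating by parts, the conditions on `w` are moments against `1`, against `(β
j / λ j) e^{-λ j t}` for `λ j ≠ 0`, and, if some `λ j = 0`, against `t`. Bessel's inequality makes
the data square summable, so strong minimality settles all moments except the last
(`exists_inner_eq_of_strongly_minimal`).

The moment against `t` is the delicate point: some annihilator of the family must have nonzero first
moment (`exists_annihilator_moment_ne_zero`). Otherwise the transform of any annihilator can be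
divided by `z` indefinitely, so it has a zero of infinite order at `0` and vanishes identically: no
annihilator has a nonzero transform. Choose `Δ = 1 + ŵ` vanishing at all frequencies. Then the
biorthogonal transforms are multiples of `Δ(z)/(z - μ i)`, and expanding `1 - Δ` in them gives `1/Δ
- 1 = ∑ ρ i / (z - μ i)` with `ρ` in `ℓ²`. The zeros of `Δ` have at most linear density, so the sum
is small on suitable arbitrarily large circles; there `|Δ| ≤ 2`, and `Δ` is constant by Liouville.
This is impossible, since `Δ` has zeros but is not zero.

For the second equation, `c ∈ D(A₂*)` makes `(c, S₂(t) b₂)` continuously differentiable. Integrating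
by parts, the output becomes a Volterra expression of the second kind in `U = ∫ u`, with leading
coefficient `(c, b₂) ≠ 0`. It is inverted by a contraction in an exponentially weighted norm;
solving the differentiated equation first yields `u ∈ L²` (`exists_memLp_volterra`). -/

/-! ### Complex-valued absolutely continuous functions and integration by parts. -/

theorem intervalIntegrable_of_memLp_volIcc {T : ℝ} (hT : 0 ≤ T) {w : ℝ → ℂ}
    (hw : MemLp w 2 (volIcc T)) : IntervalIntegrable w volume 0 T := by
  rw [intervalIntegrable_iff_integrableOn_Icc_of_le hT]
  exact hw.integrable (by norm_num)

theorem AbsolutelyContinuousOnInterval.ofReal {f : ℝ → ℝ} {a b : ℝ}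
    (hf : AbsolutelyContinuousOnInterval f a b) :
    AbsolutelyContinuousOnInterval (fun x => (f x : ℂ)) a b := by
  unfold AbsolutelyContinuousOnInterval at *
  refine hf.congr fun E => ?_
  simp [Complex.dist_eq, Real.dist_eq, ← Complex.ofReal_sub]

theorem AbsolutelyContinuousOnInterval.comp_lipschitz {E F : Type*} [PseudoMetricSpace E]
    [PseudoMetricSpace F] {f : ℝ → E} {g : E → F}
    {a b : ℝ} (hf : AbsolutelyContinuousOnInterval f a b) (hg : LipschitzWith 1 g) :
    AbsolutelyContinuousOnInterval (fun x => g (f x)) a b := by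
  unfold AbsolutelyContinuousOnInterval at *
  refine squeeze_zero (fun _ => Finset.sum_nonneg fun _ _ => dist_nonneg) (fun E => ?_) hf
  refine Finset.sum_le_sum fun i _ => ?_
  simpa using hg.dist_le_mul (f (E.2 i).1) (f (E.2 i).2)

theorem IntervalIntegrable.re_part {f : ℝ → ℂ} {a b : ℝ} (h : IntervalIntegrable f volume a b) :
    IntervalIntegrable (fun x => (f x).re) volume a b :=
  ⟨h.1.re, h.2.re⟩

theorem IntervalIntegrable.im_part {f : ℝ → ℂ} {a b : ℝ} (h : IntervalIntegrable f volume a b) :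
    IntervalIntegrable (fun x => (f x).im) volume a b :=
  ⟨h.1.im, h.2.im⟩

theorem IntervalIntegrable.zero_left_of_mem {E : Type*} [NormedAddCommGroup E] {f : ℝ → E}
    {T t : ℝ} (h : IntervalIntegrable f volume 0 T) (ht : t ∈ Icc 0 T) :
    IntervalIntegrable f volume 0 t :=
  h.mono_set (by
    rw [uIcc_of_le ht.1, uIcc_of_le (ht.1.trans ht.2)]; exact Icc_subset_Icc_right ht.2)

/-- The primitive of a complex-valued integrable function is absolutely continuous. -/
theorem absolutelyContinuousOnInterval_primitive {f : ℝ → ℂ} {T : ℝ} (hT : 0 ≤ T)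
    (h : IntervalIntegrable f volume 0 T) (a : ℂ) :
    AbsolutelyContinuousOnInterval (fun x => a + ∫ s in (0 : ℝ)..x, f s) 0 T := by
  have h0 : (0 : ℝ) ∈ uIcc 0 T := left_mem_uIcc
  have hre := (h.re_part.absolutelyContinuousOnInterval_intervalIntegral h0).ofReal
  have him := ((h.im_part.absolutelyContinuousOnInterval_intervalIntegral h0).ofReal).const_smul
    Complex.I
  have hc : AbsolutelyContinuousOnInterval (fun _ : ℝ => a) 0 T :=
    (LipschitzWith.const a).lipschitzOnWith.absolutelyContinuousOnInterval
  have hs := hc.add (hre.add him)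
  unfold AbsolutelyContinuousOnInterval at hs ⊢
  refine hs.congr' ?_
  -- Splitting into real and imaginary parts is justified only on `[0, T]`; the filter restricts to
  -- interval families with end points there.
  have hmem : ∀ᶠ E : ℕ × (ℕ → ℝ × ℝ) in
      AbsolutelyContinuousOnInterval.totalLengthFilter ⊓
        𝓟 (AbsolutelyContinuousOnInterval.disjWithin 0 T),
      E ∈ AbsolutelyContinuousOnInterval.disjWithin 0 T :=
    eventually_inf_principal.mpr (Eventually.of_forall fun _ h => h)
  have key : ∀ x ∈ uIcc 0 T, ((∫ s in (0 : ℝ)..x, (f s).re : ℝ) : ℂ) +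
      Complex.I * ((∫ s in (0 : ℝ)..x, (f s).im : ℝ) : ℂ) = ∫ s in (0 : ℝ)..x, f s := by
    intro x hx
    rw [uIcc_of_le hT] at hx
    have hx' := h.zero_left_of_mem hx
    rw [← intervalIntegral.integral_ofReal, ← intervalIntegral.integral_ofReal,
      ← intervalIntegral.integral_const_mul, ← intervalIntegral.integral_add]
    · refine intervalIntegral.integral_congr fun s _ => ?_
      rw [mul_comm]; exact Complex.re_add_im (f s)
    · exact ⟨hx'.re_part.1.ofReal, hx'.re_part.2.ofReal⟩
    · exact IntervalIntegrable.const_mul ⟨hx'.im_part.1.ofReal, hx'.im_part.2.ofReal⟩ _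
  filter_upwards [hmem] with E hE
  refine Finset.sum_congr rfl fun i hi => ?_
  obtain ⟨h1, h2⟩ := hE.1 i hi
  simp only [Pi.add_apply, smul_eq_mul]
  rw [key _ h1, key _ h2]

/-- Two absolutely continuous functions with the same derivative almost everywhere and the same
initial value agree. -/
theorem AbsolutelyContinuousOnInterval.eqOn_of_ae_hasDerivAt {f g f' : ℝ → ℂ} {T : ℝ}
    (hT : 0 ≤ T)
    (hf : AbsolutelyContinuousOnInterval f 0 T) (hg : AbsolutelyContinuousOnInterval g 0 T)
    (hf' : ∀ᵐ x, x ∈ uIcc 0 T → HasDerivAt f (f' x) x)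
    (hg' : ∀ᵐ x, x ∈ uIcc 0 T → HasDerivAt g (f' x) x) (h0 : f 0 = g 0) :
    EqOn f g (Icc 0 T) := by
  obtain ⟨C, hC⟩ := (hf.sub hg).const_of_ae_hasDerivAt_zero (by
    filter_upwards [hf', hg'] with x h1 h2 hx
    simpa using (h1 hx).sub (h2 hx))
  have hC0 := hC (x := 0) left_mem_uIcc
  intro x hx
  have hCx := hC (x := x) (by rwa [uIcc_of_le hT])
  simp only [Pi.sub_apply] at hC0 hCx
  rw [h0, sub_self] at hC0
  exact sub_eq_zero.1 (hCx.trans hC0.symm)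

theorem ae_hasDerivAt_primitive {f : ℝ → ℂ} {T : ℝ}
    (h : IntervalIntegrable f volume 0 T) (a : ℂ) :
    ∀ᵐ x, x ∈ uIcc 0 T → HasDerivAt (fun x => a + ∫ s in (0 : ℝ)..x, f s) (f x) x := by
  filter_upwards [h.ae_hasDerivAt_integral] with x hx hxT
  exact (hx hxT 0 left_mem_uIcc).const_add a

theorem AbsolutelyContinuousOnInterval.ae_hasDerivAt_complex {f : ℝ → ℂ} {a b : ℝ}
    (hf : AbsolutelyContinuousOnInterval f a b) :
    ∀ᵐ x, x ∈ uIcc a b → HasDerivAt f (deriv f x) x := by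
  have h1 := (hf.comp_lipschitz (g := Complex.re)
    (LipschitzWith.of_dist_le_mul fun x y => by
      simpa [Complex.dist_eq, Real.dist_eq] using Complex.abs_re_le_norm (x - y))).ae_differentiableAt
  have h2 := (hf.comp_lipschitz (g := Complex.im)
    (LipschitzWith.of_dist_le_mul fun x y => by
      simpa [Complex.dist_eq, Real.dist_eq] using Complex.abs_im_le_norm (x - y))).ae_differentiableAt
  filter_upwards [h1, h2] with x h1 h2 hx
  have h := ((h1 hx).hasDerivAt.ofReal_comp).add
    (((h2 hx).hasDerivAt.ofReal_comp).mul_const Complex.I)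
  have : DifferentiableAt ℝ f x := by
    refine h.differentiableAt.congr_of_eventuallyEq (Eventually.of_forall fun y => ?_)
    exact (Complex.re_add_im (f y)).symm
  exact this.hasDerivAt

/-- The fundamental theorem of calculus for complex-valued absolutely continuous functions. -/
theorem AbsolutelyContinuousOnInterval.eq_add_integral_deriv {f : ℝ → ℂ} {T : ℝ} (hT : 0 ≤ T)
    (hf : AbsolutelyContinuousOnInterval f 0 T) (hi : IntervalIntegrable (deriv f) volume 0 T) :
    ∀ t ∈ Icc 0 T, f t = f 0 + ∫ s in (0 : ℝ)..t, deriv f s :=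
  hf.eqOn_of_ae_hasDerivAt hT (absolutelyContinuousOnInterval_primitive hT hi (f 0))
    hf.ae_hasDerivAt_complex (ae_hasDerivAt_primitive hi _) (by simp)

theorem continuousOn_primitive_Icc {f : ℝ → ℂ} {T : ℝ} (hT : 0 ≤ T)
    (h : IntervalIntegrable f volume 0 T) (a : ℂ) :
    ContinuousOn (fun x => a + ∫ s in (0 : ℝ)..x, f s) (Icc 0 T) := by
  have := (absolutelyContinuousOnInterval_primitive hT h a).continuousOn
  rwa [uIcc_of_le hT] at this

/-- Integration by parts for a `C¹` function and the primitive of an integrable function. -/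
theorem integral_mul_add_integral_deriv_mul_primitive {f e e' : ℝ → ℂ} {T : ℝ} (hT : 0 ≤ T)
    (h : IntervalIntegrable f volume 0 T) (he : ∀ x, HasDerivAt e (e' x) x)
    (he' : Continuous e') (a : ℂ) :
    (∫ t in (0 : ℝ)..T, e t * f t) + ∫ t in (0 : ℝ)..T, e' t * (a + ∫ s in (0 : ℝ)..t, f s)
      = e T * (a + ∫ s in (0 : ℝ)..T, f s) - e 0 * a := by
  set F : ℝ → ℂ := fun t => a + ∫ s in (0 : ℝ)..t, f s with hF
  have hFc := continuousOn_primitive_Icc hT h a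
  have hec : Continuous e := continuous_iff_continuousAt.2 fun x => (he x).continuousAt
  have i1 : IntervalIntegrable (fun t => e t * f t) volume 0 T :=
    h.continuousOn_mul hec.continuousOn
  have i2 : IntervalIntegrable (fun t => e' t * F t) volume 0 T := by
    refine ContinuousOn.intervalIntegrable ?_
    rw [uIcc_of_le hT]
    exact he'.continuousOn.mul hFc
  have hder : deriv e = e' := funext fun x => (he x).deriv
  have hC1 : ContDiff ℝ 1 e := contDiff_one_iff_deriv.2 ⟨fun x => (he x).differentiableAt,
    hder ▸ he'⟩
  have hAC : AbsolutelyContinuousOnInterval (e • F) 0 T :=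
    hC1.contDiffOn.absolutelyContinuousOnInterval.smul
      (absolutelyContinuousOnInterval_primitive hT h a)
  have key := hAC.eqOn_of_ae_hasDerivAt (f' := fun t => e t * f t + e' t * F t) hT
    (absolutelyContinuousOnInterval_primitive hT (i1.add i2) (e 0 * a)) ?_
    (ae_hasDerivAt_primitive (i1.add i2) _) (by simp [hF])
  · have := key (right_mem_Icc.2 hT)
    simp only [Pi.smul_apply', smul_eq_mul] at this
    rw [intervalIntegral.integral_add i1 i2] at this
    change _ = e T * F T - e 0 * a
    rw [this]; ring
  · filter_upwards [ae_hasDerivAt_primitive h a] with x hx hxT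
    have := (he x).mul (hx hxT)
    rw [add_comm]
    exact this

/-! ### Finite Laplace transforms and division by their zeros. -/

/-- The finite two-sided Laplace transform `z ↦ ∫₀ᵀ e^{zt} w(t) dt`. -/
noncomputable def expTransform (T : ℝ) (w : ℝ → ℂ) (z : ℂ) : ℂ :=
  ∫ t in (0 : ℝ)..T, Complex.exp (z * t) * w t

theorem ContinuousOn.memLp_volIcc {T : ℝ} {f : ℝ → ℂ} (hf : ContinuousOn f (Icc 0 T)) :
    MemLp f 2 (volIcc T) := by
  obtain ⟨C, hC⟩ := isCompact_Icc.exists_bound_of_continuousOn hf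
  exact MemLp.of_bound (hf.aestronglyMeasurable measurableSet_Icc) C
    ((ae_restrict_iff' measurableSet_Icc).2 (Eventually.of_forall hC))

theorem intervalIntegrable_exp_mul {T : ℝ} {w : ℝ → ℂ} (h : IntervalIntegrable w volume 0 T)
    (z : ℂ) : IntervalIntegrable (fun t : ℝ => Complex.exp (z * t) * w t) volume 0 T :=
  h.continuousOn_mul (by fun_prop)

theorem expTransform_zero (T : ℝ) (w : ℝ → ℂ) :
    expTransform T w 0 = ∫ t in (0 : ℝ)..T, w t := by
  simp [expTransform]

theorem expTransform_add {T : ℝ} {w w' : ℝ → ℂ} (h : IntervalIntegrable w volume 0 T)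
    (h' : IntervalIntegrable w' volume 0 T) (z : ℂ) :
    expTransform T (fun t => w t + w' t) z = expTransform T w z + expTransform T w' z := by
  simp only [expTransform]
  rw [← intervalIntegral.integral_add (intervalIntegrable_exp_mul h z)
    (intervalIntegrable_exp_mul h' z)]
  simp only [mul_add]

theorem expTransform_const_mul (T : ℝ) (k : ℂ) (w : ℝ → ℂ) (z : ℂ) :
    expTransform T (fun t => k * w t) z = k * expTransform T w z := by
  simp only [expTransform]
  rw [← intervalIntegral.integral_const_mul]
  congr 1; ext t; ring

theorem norm_exp_mul_ofReal_le {T t : ℝ} (ht : t ∈ Icc 0 T) (z : ℂ) :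
    ‖Complex.exp (z * t)‖ ≤ Real.exp (T * ‖z‖) := by
  rw [Complex.norm_exp]
  apply Real.exp_le_exp.2
  have h1 : (z * (t : ℂ)).re = t * z.re := by simp [mul_comm]
  rw [h1]
  calc t * z.re ≤ t * ‖z‖ := by gcongr; exacts [ht.1, Complex.re_le_norm z]
    _ ≤ T * ‖z‖ := by gcongr; exact ht.2

theorem norm_expTransform_le {T : ℝ} (hT : 0 ≤ T) {w : ℝ → ℂ}
    (h : IntervalIntegrable w volume 0 T) (z : ℂ) :
    ‖expTransform T w z‖ ≤ Real.exp (T * ‖z‖) * ∫ t in (0 : ℝ)..T, ‖w t‖ := by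
  rw [← intervalIntegral.integral_const_mul]
  refine intervalIntegral.norm_integral_le_of_norm_le hT ?_ (h.norm.const_mul _)
  refine Eventually.of_forall fun t ht => ?_
  rw [norm_mul]
  gcongr
  exact norm_exp_mul_ofReal_le ⟨ht.1.le, ht.2⟩ z

theorem hasDerivAt_expTransform {T : ℝ} (hT : 0 ≤ T) {w : ℝ → ℂ}
    (h : IntervalIntegrable w volume 0 T) (z : ℂ) :
    HasDerivAt (expTransform T w) (∫ t in (0 : ℝ)..T, Complex.exp (z * t) * t * w t) z := by
  have hF' : IntervalIntegrable (fun t : ℝ => Complex.exp (z * (t : ℂ)) * t * w t) volume 0 T :=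
    h.continuousOn_mul (g := fun t : ℝ => Complex.exp (z * (t : ℂ)) * t) (by fun_prop)
  have key := intervalIntegral.hasDerivAt_integral_of_dominated_loc_of_deriv_le
    (μ := volume) (a := 0) (b := T) (x₀ := z) (s := Metric.ball z 1)
    (F := fun z t => Complex.exp (z * (t : ℂ)) * w t)
    (F' := fun z t => Complex.exp (z * (t : ℂ)) * t * w t)
    (bound := fun t => Real.exp (T * (‖z‖ + 1)) * T * ‖w t‖)
    (Metric.ball_mem_nhds z one_pos)
    (Eventually.of_forall fun x => (intervalIntegrable_exp_mul h x).aestronglyMeasurable_restrict_uIoc)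
    (intervalIntegrable_exp_mul h z)
    hF'.aestronglyMeasurable_restrict_uIoc
    (Eventually.of_forall fun t ht x hx => by
      rw [uIoc_of_le hT] at ht
      have hxn : ‖x‖ ≤ ‖z‖ + 1 := by
        have : ‖x - z‖ < 1 := by simpa [dist_eq_norm] using hx
        calc ‖x‖ = ‖z + (x - z)‖ := by ring_nf
          _ ≤ ‖z‖ + ‖x - z‖ := norm_add_le _ _
          _ ≤ _ := by linarith
      rw [norm_mul, norm_mul]
      have h1 : ‖(t : ℂ)‖ ≤ T := by
        rw [Complex.norm_real, Real.norm_of_nonneg ht.1.le]; exact ht.2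
      have h2 : ‖Complex.exp (x * t)‖ ≤ Real.exp (T * (‖z‖ + 1)) :=
        (norm_exp_mul_ofReal_le ⟨ht.1.le, ht.2⟩ x).trans
          (Real.exp_le_exp.2 (by gcongr))
      gcongr)
    (h.norm.const_mul _)
    (Eventually.of_forall fun t _ x _ => by
      have : HasDerivAt (fun x : ℂ => Complex.exp (x * (t : ℂ))) (Complex.exp (x * t) * t) x := by
        simpa using ((hasDerivAt_id x).mul_const (t : ℂ)).cexp
      exact this.mul_const (w t))
  exact key.2

theorem differentiable_expTransform {T : ℝ} (hT : 0 ≤ T) {w : ℝ → ℂ}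
    (h : IntervalIntegrable w volume 0 T) : Differentiable ℂ (expTransform T w) :=
  fun z => (hasDerivAt_expTransform hT h z).differentiableAt

/-- Dominated convergence, since `e^{-xt} → 0` for every `t > 0`. It guarantees later that `1 + ŵ`
is not identically zero. -/
theorem tendsto_expTransform_neg_atTop {T : ℝ} (hT : 0 ≤ T) {w : ℝ → ℂ}
    (h : IntervalIntegrable w volume 0 T) :
    Tendsto (fun x : ℝ => expTransform T w (-(x : ℂ))) atTop (𝓝 0) := by
  have := intervalIntegral.tendsto_integral_filter_of_dominated_convergence
    (μ := volume) (a := 0) (b := T) (l := (atTop : Filter ℝ))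
    (F := fun (x : ℝ) (t : ℝ) => Complex.exp (-(x : ℂ) * t) * w t) (f := fun _ => 0)
    (fun t => ‖w t‖)
    (Eventually.of_forall fun x => (intervalIntegrable_exp_mul h _).aestronglyMeasurable_restrict_uIoc)
    (by
      filter_upwards [eventually_ge_atTop 0] with x hx
      refine Eventually.of_forall fun t ht => ?_
      rw [uIoc_of_le hT] at ht
      rw [norm_mul, Complex.norm_exp]
      have : (-(x : ℂ) * t).re = -(x * t) := by simp
      rw [this]
      refine mul_le_of_le_one_left (norm_nonneg _) (Real.exp_le_one_iff.2 ?_)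
      have := mul_nonneg hx ht.1.le
      linarith)
    h.norm
    (Eventually.of_forall fun t ht => by
      rw [uIoc_of_le hT] at ht
      rw [← zero_mul (w t)]
      refine Tendsto.mul_const _ ?_
      rw [tendsto_zero_iff_norm_tendsto_zero]
      have : ∀ x : ℝ, ‖Complex.exp (-(x : ℂ) * t)‖ = Real.exp (-(x * t)) := fun x => by
        rw [Complex.norm_exp]; simp
      simp only [this]
      exact Real.tendsto_exp_neg_atTop_nhds_zero.comp (tendsto_id.atTop_mul_const ht.1))
  simpa [expTransform] using this

/-- If `α + ∫₀ᵀ e^{zt} w(t) dt` vanishes at `μ`, then its quotient by `z - μ` is again the transform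
of a square integrable function. -/
theorem exists_expTransform_mul_sub_eq {T : ℝ} (hT : 0 ≤ T) {w : ℝ → ℂ}
    (hw : IntervalIntegrable w volume 0 T) (α μ : ℂ) (h0 : α + expTransform T w μ = 0) :
    ∃ f : ℝ → ℂ, ContinuousOn f (Icc 0 T) ∧
      ∀ z, (z - μ) * expTransform T f z = α + expTransform T w z := by
  have hwμ := intervalIntegrable_exp_mul hw μ
  have hc := continuousOn_primitive_Icc hT hwμ α
  -- Integrating `e^{(z-μ)t}` by parts against the primitive `α + ∫ e^{μs} w` produces the factor `z
  -- - μ`. The boundary term at `T` vanishes by `h0`, and the one at `0` supplies `α`.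
  refine ⟨fun t => -(Complex.exp (-μ * t) * (α + ∫ s in (0 : ℝ)..t, Complex.exp (μ * s) * w s)),
    ((by fun_prop : Continuous fun t : ℝ => Complex.exp (-μ * t)).continuousOn.mul hc).neg,
    fun z => ?_⟩
  have ibp := integral_mul_add_integral_deriv_mul_primitive hT hwμ
    (e := fun t : ℝ => Complex.exp ((z - μ) * t))
    (e' := fun t : ℝ => (z - μ) * Complex.exp ((z - μ) * t))
    (fun x => by
      have : HasDerivAt (fun x : ℝ => ((z - μ) * (x : ℂ))) ((z - μ) * 1) x :=
        (HasDerivAt.ofReal_comp (hasDerivAt_id x)).const_mul _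
      simpa [mul_comm] using this.cexp) (by fun_prop) α
  have e1 : (∫ t in (0 : ℝ)..T, Complex.exp ((z - μ) * t) * (Complex.exp (μ * t) * w t))
      = expTransform T w z := by
    refine intervalIntegral.integral_congr fun t _ => ?_
    rw [← mul_assoc, ← Complex.exp_add]; ring_nf
  have e2 : α + (∫ s in (0 : ℝ)..T, Complex.exp (μ * s) * w s) = 0 := h0
  rw [e1, e2] at ibp
  simp only [Complex.ofReal_zero, mul_zero, Complex.exp_zero, one_mul, zero_sub] at ibp
  have e3 : (z - μ) * expTransform T (fun t => -(Complex.exp (-μ * t) *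
      (α + ∫ s in (0 : ℝ)..t, Complex.exp (μ * s) * w s))) z =
      -∫ t in (0 : ℝ)..T, (z - μ) * Complex.exp ((z - μ) * t) *
        (α + ∫ s in (0 : ℝ)..t, Complex.exp (μ * s) * w s) := by
    rw [expTransform, ← intervalIntegral.integral_const_mul, ← intervalIntegral.integral_neg]
    refine intervalIntegral.integral_congr fun t _ => ?_
    rw [show (z - μ) * (t : ℂ) = z * t + -μ * t by ring, Complex.exp_add]; ring
  rw [e3]
  linear_combination -ibp

/-- If every square integrable function whose transform vanishes on `Z ∋ 0` has vanishing first
moment, then all these transforms vanish identically. -/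
theorem expTransform_eq_zero_of_forall_moment {T : ℝ} (hT : 0 ≤ T) {Z : Set ℂ} (hZ : (0 : ℂ) ∈ Z)
    (hmom : ∀ w : ℝ → ℂ, MemLp w 2 (volIcc T) → (∀ z ∈ Z, expTransform T w z = 0) →
      ∫ t in (0 : ℝ)..T, (t : ℂ) * w t = 0)
    {w : ℝ → ℂ} (hw : MemLp w 2 (volIcc T)) (hwZ : ∀ z ∈ Z, expTransform T w z = 0) (z : ℂ) :
    expTransform T w z = 0 := by
  -- The quotient `ŵ(z)/z` takes at `0` the value `ŵ'(0) = ∫ t w`, which is zero by `hmom`. So it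
  -- vanishes on all of `Z`, and the division can be repeated.
  have step : ∀ w : ℝ → ℂ, MemLp w 2 (volIcc T) → (∀ z ∈ Z, expTransform T w z = 0) →
      ∃ f : ℝ → ℂ, MemLp f 2 (volIcc T) ∧ (∀ z ∈ Z, expTransform T f z = 0) ∧
        ∀ z, expTransform T w z = z * expTransform T f z := by
    intro w hw hwZ
    have hi := intervalIntegrable_of_memLp_volIcc hT hw
    obtain ⟨f, hf, hfz⟩ := exists_expTransform_mul_sub_eq hT hi 0 0 (by simpa using hwZ 0 hZ)
    have hfz' : ∀ z, z * expTransform T f z = expTransform T w z := by simpa using hfz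
    have hfd := differentiable_expTransform hT
      (intervalIntegrable_of_memLp_volIcc hT hf.memLp_volIcc)
    have hf0 : expTransform T f 0 = 0 := by
      have h1 := hasDerivAt_expTransform hT hi 0
      have h2 : HasDerivAt (expTransform T w) (1 * expTransform T f 0 +
          0 * deriv (expTransform T f) 0) 0 :=
        ((hasDerivAt_id (0 : ℂ)).mul (hfd 0).hasDerivAt).congr_of_eventuallyEq
          (Eventually.of_forall fun z => (hfz' z).symm)
      have h3 := h2.unique h1
      simpa [hmom w hw hwZ] using h3
    refine ⟨f, hf.memLp_volIcc, fun z hz => ?_, fun z => (hfz' z).symm⟩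
    by_cases hz0 : z = 0
    · rw [hz0, hf0]
    · have := hfz' z
      rw [hwZ z hz] at this
      exact (mul_eq_zero.1 this).resolve_left hz0
  have iter : ∀ n : ℕ, ∃ f : ℝ → ℂ, MemLp f 2 (volIcc T) ∧ (∀ z ∈ Z, expTransform T f z = 0) ∧
        ∀ z, expTransform T w z = z ^ n * expTransform T f z := by
    intro n
    induction n with
    | zero => exact ⟨w, hw, hwZ, by simp⟩
    | succ n ih =>
      obtain ⟨f, hf, hfZ, h⟩ := ih
      obtain ⟨g, hg, hgZ, h'⟩ := step f hf hfZ
      exact ⟨g, hg, hgZ, fun z => by rw [h, h', pow_succ]; ring⟩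
  have hd := differentiable_expTransform hT (intervalIntegrable_of_memLp_volIcc hT hw)
  have han : AnalyticOnNhd ℂ (expTransform T w) univ := fun z _ => hd.analyticAt z
  by_cases hev : ∀ᶠ z in 𝓝 (0 : ℂ), expTransform T w z = 0
  · exact han.eqOn_zero_of_preconnected_of_eventuallyEq_zero isPreconnected_univ (mem_univ 0) hev
      (mem_univ z)
  -- A finite order `n` at `0` is impossible: after `n` divisions the quotient must be nonzero at
  -- `0`, yet it still vanishes on `Z ∋ 0`.
  · obtain ⟨n, g, hg, hg0, hge⟩ :=
      (hd.analyticAt 0).exists_eventuallyEq_pow_smul_nonzero_iff.2 hev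
    obtain ⟨f, hf, hfZ, hfz⟩ := iter n
    have hfd := differentiable_expTransform hT (intervalIntegrable_of_memLp_volIcc hT hf)
    have heq : ∀ᶠ z in 𝓝[≠] (0 : ℂ), g z = expTransform T f z := by
      filter_upwards [hge.filter_mono nhdsWithin_le_nhds, self_mem_nhdsWithin] with z hz hz0
      rw [hfz, sub_zero, smul_eq_mul] at hz
      exact (mul_left_cancel₀ (pow_ne_zero n hz0) hz).symm
    have h1 : Tendsto g (𝓝[≠] 0) (𝓝 (g 0)) := hg.continuousAt.tendsto.mono_left nhdsWithin_le_nhds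
    have h2 : Tendsto (expTransform T f) (𝓝[≠] 0) (𝓝 (expTransform T f 0)) :=
      (hfd 0).continuousAt.tendsto.mono_left nhdsWithin_le_nhds
    exact absurd ((tendsto_nhds_unique h1 (h2.congr' (heq.mono fun _ h => h.symm))).trans
      (hfZ 0 hZ)) hg0

/-! ### Entire functions: density of zeros, good circles and partial fractions. -/

/-- A Jensen-type bound for the number of zeros of an entire function in a disc. -/
theorem norm_mul_two_pow_card_le {R : ℝ} (hR : 0 < R) (s : Finset ℂ) :
    ∀ (f : ℂ → ℂ) (M : ℝ), Differentiable ℂ f → (∀ a ∈ s, ‖a‖ ≤ R ∧ f a = 0) →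
      (∀ z, ‖z‖ = 3 * R → ‖f z‖ ≤ M) → ‖f 0‖ * 2 ^ s.card ≤ M := by
  classical
  induction s using Finset.induction_on with
  | empty =>
    intro f M hf _ hM
    have := Complex.norm_le_of_forall_mem_frontier_norm_le (U := Metric.ball (0 : ℂ) (3 * R))
      Metric.isBounded_ball hf.diffContOnCl (C := M) (fun z hz => by
        rw [frontier_ball _ (by positivity)] at hz
        exact hM z (by simpa using hz))
      (subset_closure (Metric.mem_ball_self (by positivity)))
    simpa using this
  | insert a s ha ih =>
    intro f M hf hs hM
    obtain ⟨haR, hfa⟩ := hs a (Finset.mem_insert_self _ _)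
    -- Dividing out the zero `a` costs at most `R` at the origin and gains at least `2R` on the
    -- circle of radius `3R`, hence a factor `2` per zero.
    have hg : Differentiable ℂ (dslope f a) := by
      rw [← differentiableOn_univ, Complex.differentiableOn_dslope univ_mem]
      exact hf.differentiableOn
    have hfg : ∀ z, f z = (z - a) * dslope f a z := fun z => by
      have := sub_smul_dslope f a z
      rw [hfa, sub_zero, smul_eq_mul] at this
      exact this.symm
    have h1 := ih (dslope f a) (M / (2 * R)) hg
      (fun b hb => ⟨(hs b (Finset.mem_insert_of_mem hb)).1, by
        have h2 := (hs b (Finset.mem_insert_of_mem hb)).2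
        rw [hfg] at h2
        exact (mul_eq_zero.1 h2).resolve_left
          (sub_ne_zero.2 fun h => ha (h ▸ hb))⟩)
      (fun z hz => by
        rw [le_div_iff₀ (by positivity)]
        have h2 := hM z hz
        rw [hfg, norm_mul] at h2
        have h3 : 2 * R ≤ ‖z - a‖ := by
          have := norm_sub_norm_le z a
          linarith
        calc _ ≤ ‖dslope f a z‖ * ‖z - a‖ := by gcongr
          _ ≤ M := by rwa [mul_comm])
    rw [le_div_iff₀ (by positivity)] at h1
    rw [Finset.card_insert_of_notMem ha, hfg 0, norm_mul, zero_sub, norm_neg, pow_succ]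
    calc ‖a‖ * ‖dslope f a 0‖ * (2 ^ s.card * 2) ≤ R * ‖dslope f a 0‖ * (2 ^ s.card * 2) := by
          gcongr
      _ = ‖dslope f a 0‖ * 2 ^ s.card * (2 * R) := by ring
      _ ≤ M := h1

/-- The zeros of an entire function of exponential type have at most linear density. -/
theorem exists_card_zeros_le {f : ℂ → ℂ} (hf : Differentiable ℂ f) {A T : ℝ} (hT : 0 ≤ T)
    (hA : ∀ z, ‖f z‖ ≤ Real.exp (T * ‖z‖) * A) {z₀ : ℂ} (hz₀ : f z₀ ≠ 0) :
    ∃ K : ℝ, 1 ≤ K ∧ ∀ R : ℝ, 1 ≤ R → ∀ s : Finset ℂ, (∀ a ∈ s, ‖a‖ ≤ R ∧ f a = 0) →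
      (s.card : ℝ) ≤ K * R := by
  classical
  have hA0 : 0 < A := by
    have h1 := (norm_pos_iff.2 hz₀).trans_le (hA z₀)
    exact (mul_pos_iff_of_pos_left (Real.exp_pos _)).1 h1
  set L : ℝ := Real.log (A / ‖f z₀‖) with hL
  -- The zero count is recentred at `z₀`, with radius `R + ‖z₀‖`; the circle of three times this
  -- radius lies in `‖z‖ ≤ 3R + 4‖z₀‖`. Taking logarithms gives the constant.
  set K : ℝ := max 1 ((|L| + T * (3 + 4 * ‖z₀‖)) / Real.log 2) with hK
  have hlog2 : 0 < Real.log 2 := Real.log_pos (by norm_num)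
  refine ⟨K, le_max_left _ _, fun R hR s hs => ?_⟩
  have key := norm_mul_two_pow_card_le (R := R + ‖z₀‖) (by positivity)
    (s.image fun a => a - z₀) (fun z => f (z₀ + z)) (Real.exp (T * (3 * R + 4 * ‖z₀‖)) * A)
    (hf.comp (by fun_prop)) (by
      intro b hb
      obtain ⟨a, ha, rfl⟩ := Finset.mem_image.1 hb
      refine ⟨(norm_sub_le _ _).trans (by linarith [(hs a ha).1]), ?_⟩
      simpa using (hs a ha).2)
    (fun z hz => (hA _).trans (by
      have : ‖z₀ + z‖ ≤ 3 * R + 4 * ‖z₀‖ := (norm_add_le _ _).trans (by linarith)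
      gcongr))
  rw [Finset.card_image_of_injective _ (sub_left_injective), add_zero] at key
  have hpos : 0 < ‖f z₀‖ := norm_pos_iff.2 hz₀
  have key2 : (2 : ℝ) ^ s.card ≤ Real.exp (T * (3 * R + 4 * ‖z₀‖)) * (A / ‖f z₀‖) := by
    rw [← mul_div_assoc, le_div_iff₀ hpos, mul_comm]; exact key
  have key3 := Real.log_le_log (by positivity) key2
  rw [Real.log_pow, Real.log_mul (Real.exp_ne_zero _) (by positivity), Real.log_exp, ← hL] at key3
  have : (s.card : ℝ) ≤ (|L| + T * (3 + 4 * ‖z₀‖)) / Real.log 2 * R := by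
    rw [div_mul_eq_mul_div, le_div_iff₀ hlog2]
    have h1 : L ≤ |L| * R := (le_abs_self L).trans (le_mul_of_one_le_right (abs_nonneg _) hR)
    have h2 : T * (3 * R + 4 * ‖z₀‖) ≤ T * (3 + 4 * ‖z₀‖) * R := by
      have : 4 * ‖z₀‖ ≤ 4 * ‖z₀‖ * R := le_mul_of_one_le_right (by positivity) hR
      nlinarith
    linarith
  exact this.trans (by gcongr; exact le_max_right _ _)

theorem integral_inv_sq_add_sq_le (r : ℝ) {η : ℝ} (hη : 0 < η) (a b : ℝ) :
    ∫ x in a..b, ((x - r) ^ 2 + η ^ 2)⁻¹ ≤ Real.pi / η := by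
  have hcont : Continuous fun x : ℝ => ((x - r) ^ 2 + η ^ 2)⁻¹ :=
    Continuous.inv₀ (by fun_prop) fun x => by positivity
  have h := intervalIntegral.integral_eq_sub_of_hasDerivAt (a := a) (b := b)
    (f := fun x => Real.arctan ((x - r) / η) / η) (f' := fun x => ((x - r) ^ 2 + η ^ 2)⁻¹)
    (fun x _ => by
      have h1 : HasDerivAt (fun x : ℝ => (x - r) / η) (1 / η) x :=
        ((hasDerivAt_id x).sub_const r).div_const η
      have h2 := h1.arctan.div_const η
      have h3 : 1 / (1 + ((x - r) / η) ^ 2) * (1 / η) / η = ((x - r) ^ 2 + η ^ 2)⁻¹ := by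
        have h4 : (x - r) ^ 2 + η ^ 2 ≠ 0 := by positivity
        have h5 : 1 + ((x - r) / η) ^ 2 = ((x - r) ^ 2 + η ^ 2) / η ^ 2 := by
          field_simp; ring
        rw [h5]
        field_simp
      exact h3 ▸ h2)
    (hcont.intervalIntegrable _ _)
  rw [h, ← sub_div]
  gcongr
  linarith [Real.arctan_lt_pi_div_two ((b - r) / η), Real.neg_pi_div_two_lt_arctan ((a - r) / η)]

/-- Among the radii in `[N, 2N]` there is one which is well separated from finitely many given
points. -/
theorem exists_radius_sum_inv_sq_le {I : Type*} (r : I → ℝ) (s : Finset I) {m N : ℝ} (hm : 1 ≤ m)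
    (hs : (s.card : ℝ) ≤ m) (hN : 0 < N) :
    ∃ R ∈ Icc N (2 * N), (∀ i ∈ s, R ≠ r i) ∧
      ∑ i ∈ s, ((R - r i) ^ 2)⁻¹ ≤ 64 * (m / N) ^ 2 := by
  have hm0 : 0 < m := by linarith
  -- The singular sum is regularised at scale `η`. Each regularised term has integral at most `π/η`,
  -- so the mean over `[N, 2N]` is below `4m/(ηN) = 32(m/N)²`.
  set η : ℝ := N / (8 * m) with hη
  have hη0 : 0 < η := by positivity
  set G : ℝ → ℝ := fun x => ∑ i ∈ s, ((x - r i) ^ 2 + η ^ 2)⁻¹ with hG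
  have hcont : ∀ i, Continuous fun x : ℝ => ((x - r i) ^ 2 + η ^ 2)⁻¹ := fun i =>
    Continuous.inv₀ (by fun_prop) fun x => by positivity
  have hGc : Continuous G := continuous_finsetSum _ fun i _ => hcont i
  have hint : ∫ x in N..2 * N, G x ≤ m * (Real.pi / η) := by
    rw [hG, intervalIntegral.integral_finsetSum fun i _ => (hcont i).intervalIntegrable _ _]
    calc _ ≤ ∑ _i ∈ s, Real.pi / η :=
          Finset.sum_le_sum fun i _ => integral_inv_sq_add_sq_le (r i) hη0 _ _
      _ = s.card * (Real.pi / η) := by simp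
      _ ≤ _ := by gcongr
  have hex : ∃ R ∈ Icc N (2 * N), G R < 32 * (m / N) ^ 2 := by
    by_contra! hcon
    have h1 := intervalIntegral.integral_mono_on (μ := volume) (a := N) (b := 2 * N) (by linarith)
      (intervalIntegrable_const (c := 32 * (m / N) ^ 2)) (hGc.intervalIntegrable _ _)
      (fun x hx => hcon x hx)
    rw [intervalIntegral.integral_const, smul_eq_mul] at h1
    have h2 : (2 * N - N) * (32 * (m / N) ^ 2) = m * (4 / η) := by
      rw [hη]; field_simp; ring
    have h3 : m * (Real.pi / η) < m * (4 / η) := by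
      gcongr; exact Real.pi_lt_four
    linarith
  obtain ⟨R, hR, hGR⟩ := hex
  -- With this `η` the bound `32(m/N)²` equals `1/(2η²)`. Hence `|R - r i| > η` for every `i ∈ s`,
  -- and removing the regularisation costs only a factor `2`.
  have hGR' : G R < (2 * η ^ 2)⁻¹ := by
    refine hGR.trans_eq ?_
    rw [hη]; field_simp; norm_num
  have hsep : ∀ i ∈ s, η ^ 2 < (R - r i) ^ 2 := by
    intro i hi
    have h1 : ((R - r i) ^ 2 + η ^ 2)⁻¹ ≤ G R :=
      Finset.single_le_sum (f := fun i => ((R - r i) ^ 2 + η ^ 2)⁻¹)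
        (fun j _ => by positivity) hi
    have h2 := (inv_lt_inv₀ (by positivity) (by positivity)).1 (h1.trans_lt hGR')
    linarith
  refine ⟨R, hR, fun i hi h => ?_, ?_⟩
  · have := hsep i hi
    rw [h, sub_self] at this
    nlinarith [sq_nonneg η]
  · calc ∑ i ∈ s, ((R - r i) ^ 2)⁻¹ ≤ ∑ i ∈ s, 2 * ((R - r i) ^ 2 + η ^ 2)⁻¹ := by
          refine Finset.sum_le_sum fun i hi => ?_
          have h1 := hsep i hi
          have h0 : 0 < η ^ 2 := by positivity
          rw [← div_eq_mul_inv, inv_eq_one_div, div_le_div_iff₀ (by linarith) (by positivity)]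
          linarith
      _ = 2 * G R := by rw [hG, Finset.mul_sum]
      _ ≤ _ := by linarith

/-- An entire function which is bounded by `2` on arbitrarily large circles is constant. -/
theorem Differentiable.apply_eq_apply_of_bounded_on_circles {f : ℂ → ℂ} (hf : Differentiable ℂ f)
    {B : ℝ} (hB : ∀ N : ℝ, ∃ R, N ≤ R ∧ ∀ z, ‖z‖ = R → ‖f z‖ ≤ B) (z w : ℂ) : f z = f w := by
  refine hf.apply_eq_apply_of_bounded (isBounded_iff_forall_norm_le.2 ⟨B, ?_⟩) z w
  rintro _ ⟨u, rfl⟩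
  obtain ⟨R, hR, h⟩ := hB (‖u‖ + 1)
  have hR0 : 0 < R := by linarith [norm_nonneg u]
  refine Complex.norm_le_of_forall_mem_frontier_norm_le (U := Metric.ball (0 : ℂ) R)
    Metric.isBounded_ball hf.diffContOnCl (fun z hz => ?_) (subset_closure ?_)
  · rw [frontier_ball _ hR0.ne'] at hz
    exact h z (by simpa using hz)
  · simp; linarith

/-- Cauchy–Schwarz, after `‖z - μ i‖ ≥ |R - ‖μ i‖|`, which makes the estimate uniform over the
circle. -/
theorem sum_div_norm_sub_le {I : Type*} {μ ρ : I → ℂ} {R δ C ε : ℝ} {z : ℂ} {v : Finset I}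
    (hε : 0 ≤ ε) (hz : ‖z‖ = R) (hne : ∀ i ∈ v, R ≠ ‖μ i‖) (hρ : ∑ i ∈ v, ‖ρ i‖ ^ 2 ≤ δ)
    (hC : ∑ i ∈ v, ((R - ‖μ i‖) ^ 2)⁻¹ ≤ C) (hδC : δ * C ≤ ε ^ 2) :
    ∑ i ∈ v, ‖ρ i‖ / ‖z - μ i‖ ≤ ε := by
  have h1 : ∑ i ∈ v, ‖ρ i‖ / ‖z - μ i‖ ≤ ∑ i ∈ v, ‖ρ i‖ * |R - ‖μ i‖|⁻¹ := by
    refine Finset.sum_le_sum fun i hi => ?_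
    rw [div_eq_mul_inv]
    have h2 : 0 < |R - ‖μ i‖| := abs_pos.2 (sub_ne_zero.2 (hne i hi))
    have h3 : |R - ‖μ i‖| ≤ ‖z - μ i‖ := by
      rw [← hz]; exact abs_norm_sub_norm_le z (μ i)
    gcongr
  have h2 := Finset.sum_mul_sq_le_sq_mul_sq v (fun i => ‖ρ i‖) (fun i => |R - ‖μ i‖|⁻¹)
  simp only [inv_pow, sq_abs] at h2
  have hC0 : 0 ≤ ∑ i ∈ v, ((R - ‖μ i‖) ^ 2)⁻¹ := Finset.sum_nonneg fun _ _ => by positivity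
  have hδ0 : 0 ≤ δ := (Finset.sum_nonneg fun _ _ => by positivity).trans hρ
  exact h1.trans (abs_le_of_sq_le_sq' (h2.trans ((mul_le_mul hρ hC hC0 hδ0).trans hδC)) hε).2

/-- For square summable weights and points of linear density, the weighted sums of inverse
distances become small on arbitrarily large circles. -/
theorem exists_large_circle_sum_le {I : Type*} {μ ρ : I → ℂ} {P K ε : ℝ} {z₀ : ℂ} (hε : 0 < ε)
    (hfin : ∀ R : ℝ, {i | ‖μ i‖ ≤ R}.Finite)
    (hρ : ∀ s : Finset I, ∑ i ∈ s, ‖ρ i‖ ^ 2 ≤ P)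
    (hsum : Summable fun i => ‖ρ i‖ / ‖z₀ - μ i‖) (hz₀ : ∀ i, z₀ ≠ μ i)
    (hK : 1 ≤ K) (hcount : ∀ R : ℝ, 1 ≤ R → ∀ s : Finset I, (∀ i ∈ s, ‖μ i‖ ≤ R) →
      (s.card : ℝ) ≤ K * R) (N₀ : ℝ) :
    ∃ R, N₀ ≤ R ∧ (∀ i, ‖μ i‖ ≠ R) ∧ ∀ z : ℂ, ‖z‖ = R → ∀ s : Finset I,
      ∑ i ∈ s, ‖ρ i‖ / ‖z - μ i‖ ≤ 3 * ε := by
  classical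
  have hsum2 : Summable fun i => ‖ρ i‖ ^ 2 :=
    summable_of_sum_le (fun i => by positivity) hρ
  -- The averaging lemma will bound the sum of inverse squared distances by `64(4K)² = (32K)²`; this
  -- `δ` makes the product `ε²`.
  obtain ⟨δ, hδ⟩ : ∃ δ : ℝ, δ = (ε / (32 * K)) ^ 2 := ⟨_, rfl⟩
  have hK0 : 0 < K := by linarith
  have hδ0 : 0 < δ := by rw [hδ]; positivity
  obtain ⟨s₁, hs₁⟩ := (summable_iff_vanishing_norm.1 hsum2) δ hδ0
  obtain ⟨s₂, hs₂⟩ := (summable_iff_vanishing_norm.1 hsum) (ε / 4) (by positivity)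
  obtain ⟨s₀, hs₀⟩ : ∃ s₀, s₀ = s₁ ∪ s₂ := ⟨_, rfl⟩
  have hsq : ∀ t : Finset I, Disjoint t s₀ → ∑ i ∈ t, ‖ρ i‖ ^ 2 ≤ δ := fun t ht =>
    (le_abs_self _).trans (hs₁ t ((hs₀ ▸ ht).mono_right Finset.subset_union_left)).le
  have hfar : ∀ t : Finset I, Disjoint t s₀ → ∑ i ∈ t, ‖ρ i‖ / ‖z₀ - μ i‖ ≤ ε / 4 := fun t ht =>
    (le_abs_self _).trans (hs₂ t ((hs₀ ▸ ht).mono_right Finset.subset_union_right)).le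
  obtain ⟨M, hM⟩ : ∃ M : ℝ, ∀ i ∈ s₀, ‖μ i‖ ≤ M :=
    ⟨∑ i ∈ s₀, ‖μ i‖, fun i hi =>
      Finset.single_le_sum (f := fun i => ‖μ i‖) (fun _ _ => norm_nonneg _) hi⟩
  obtain ⟨Q, hQ⟩ : ∃ Q : ℝ, Q = ∑ i ∈ s₀, ‖ρ i‖ := ⟨_, rfl⟩
  have hQ0 : 0 ≤ Q := hQ ▸ Finset.sum_nonneg fun _ _ => norm_nonneg _
  -- `N` exceeds `N₀` and `‖z₀‖`, and it is so far from the points of `s₀` that their total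
  -- contribution is at most `Q/(N - |M|) ≤ ε`.
  obtain ⟨N, hN⟩ : ∃ N : ℝ, N = 1 + |N₀| + |M| + ‖z₀‖ + Q / ε := ⟨_, rfl⟩
  have hQε : 0 ≤ Q / ε := by positivity
  have hN1 : 1 ≤ N := by
    have := abs_nonneg N₀; have := abs_nonneg M; have := norm_nonneg z₀; linarith
  have hN0 : 0 < N := by linarith
  obtain ⟨t, ht⟩ : ∃ t : Finset I, t = (hfin (4 * N)).toFinset := ⟨_, rfl⟩
  have hmem : ∀ i, i ∈ t ↔ ‖μ i‖ ≤ 4 * N := fun i => by simp [ht]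
  obtain ⟨R, hR, hne, hRsum⟩ := exists_radius_sum_inv_sq_le (fun i => ‖μ i‖) t
    (m := K * (4 * N)) (N := N) (by nlinarith)
    (hcount (4 * N) (by linarith) t fun i hi => (hmem i).1 hi) hN0
  have hRle := hR.1
  have hRge := hR.2
  refine ⟨R, ?_, ?_, ?_⟩
  · have := le_abs_self N₀; have := abs_nonneg M; have := norm_nonneg z₀; linarith
  · intro i h
    by_cases hi : i ∈ t
    · exact hne i hi h.symm
    · exact hi ((hmem i).2 (by linarith))
  intro z hz s
  -- Three ranges: the finitely many indices in `s₀` are handled by distance; those outside with `‖μ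
  -- i‖ ≤ 4N` by Cauchy–Schwarz on the chosen circle; those with `‖μ i‖ > 4N` by comparison with the
  -- convergent series at `z₀`.
  have hnear : ∑ i ∈ s.filter (· ∈ s₀), ‖ρ i‖ / ‖z - μ i‖ ≤ ε := by
    have h1 : ∀ i ∈ s₀, ‖ρ i‖ / ‖z - μ i‖ ≤ ‖ρ i‖ / (N - |M|) := fun i hi => by
      have h2 := hM i hi
      have h3 := norm_sub_norm_le z (μ i)
      have h4 := le_abs_self M
      have : 0 < N - |M| := by
        have := abs_nonneg N₀; have := norm_nonneg z₀; linarith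
      gcongr
      linarith
    have hpos : 0 < N - |M| := by
      have := abs_nonneg N₀; have := norm_nonneg z₀; linarith
    calc _ ≤ ∑ i ∈ s₀, ‖ρ i‖ / ‖z - μ i‖ :=
          Finset.sum_le_sum_of_subset_of_nonneg
            (fun i hi => (Finset.mem_filter.1 hi).2) fun _ _ _ => by positivity
      _ ≤ ∑ i ∈ s₀, ‖ρ i‖ / (N - |M|) := Finset.sum_le_sum h1
      _ = Q / (N - |M|) := by rw [← Finset.sum_div, hQ]
      _ ≤ ε := by
        rw [div_le_iff₀ hpos]
        have h5 : Q / ε * ε = Q := div_mul_cancel₀ _ hε.ne'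
        have : Q / ε ≤ N - |M| := by
          have := abs_nonneg N₀; have := norm_nonneg z₀; linarith
        nlinarith
  obtain ⟨u, hu⟩ : ∃ u, u = s.filter (· ∉ s₀) := ⟨_, rfl⟩
  have hdisj : ∀ v ⊆ u, Disjoint v s₀ := fun v hv => by
    rw [Finset.disjoint_left]
    intro i hi
    have := hv hi
    rw [hu] at this
    exact (Finset.mem_filter.1 this).2
  have hmid : ∑ i ∈ u.filter (· ∈ t), ‖ρ i‖ / ‖z - μ i‖ ≤ ε := by
    obtain ⟨v, hv⟩ : ∃ v, v = u.filter (· ∈ t) := ⟨_, rfl⟩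
    rw [← hv]
    have hvt : ∀ i ∈ v, i ∈ t := fun i hi => (Finset.mem_filter.1 (hv ▸ hi)).2
    have h3 : ∑ i ∈ v, ((R - ‖μ i‖) ^ 2)⁻¹ ≤ 64 * (4 * K) ^ 2 := by
      have h5 : ∑ i ∈ v, ((R - ‖μ i‖) ^ 2)⁻¹ ≤ ∑ i ∈ t, ((R - ‖μ i‖) ^ 2)⁻¹ :=
        Finset.sum_le_sum_of_subset_of_nonneg (fun i hi => hvt i hi) fun _ _ _ => by positivity
      have h6 : K * (4 * N) / N = 4 * K := by
        rw [div_eq_iff hN0.ne']; ring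
      rw [h6] at hRsum
      exact h5.trans hRsum
    refine sum_div_norm_sub_le hε.le hz (fun i hi => hne i (hvt i hi)) (hsq v (hdisj v (hv ▸ Finset.filter_subset _ _))) h3 ?_
    rw [hδ]
    have : ε / (32 * K) * (32 * K) = ε := div_mul_cancel₀ _ (by positivity)
    calc _ = (ε / (32 * K) * (32 * K)) ^ 2 := by ring
      _ ≤ _ := by rw [this]
  have hlast : ∑ i ∈ u.filter (· ∉ t), ‖ρ i‖ / ‖z - μ i‖ ≤ ε := by
    calc _ ≤ ∑ i ∈ u.filter (· ∉ t), 4 * (‖ρ i‖ / ‖z₀ - μ i‖) := by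
          refine Finset.sum_le_sum fun i hi => ?_
          have h1 : 4 * N < ‖μ i‖ := by
            have := (Finset.mem_filter.1 hi).2
            rw [hmem] at this
            exact not_le.1 this
          have h2 : ‖z₀‖ ≤ N := by
            have := abs_nonneg N₀; have := abs_nonneg M; linarith
          have h3 : ‖z₀ - μ i‖ ≤ 2 * ‖μ i‖ := (norm_sub_le _ _).trans (by linarith)
          have h4 : ‖μ i‖ / 2 ≤ ‖z - μ i‖ := by
            have := norm_sub_norm_le (μ i) z
            rw [norm_sub_rev] at this
            linarith
          have h5 : 0 < ‖z₀ - μ i‖ := norm_pos_iff.2 (sub_ne_zero.2 (hz₀ i))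
          have h6 : 0 < ‖z - μ i‖ := by linarith
          rw [← mul_div_assoc, div_le_div_iff₀ h6 h5]
          have h7 : ‖z₀ - μ i‖ ≤ 4 * ‖z - μ i‖ := by linarith
          calc ‖ρ i‖ * ‖z₀ - μ i‖ ≤ ‖ρ i‖ * (4 * ‖z - μ i‖) := by gcongr
            _ = _ := by ring
      _ = 4 * ∑ i ∈ u.filter (· ∉ t), ‖ρ i‖ / ‖z₀ - μ i‖ := by rw [Finset.mul_sum]
      _ ≤ 4 * (ε / 4) := by gcongr; exact hfar _ (hdisj _ (Finset.filter_subset _ _))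
      _ = ε := by ring
  have e1 := Finset.sum_filter_add_sum_filter_not s (· ∈ s₀) fun i => ‖ρ i‖ / ‖z - μ i‖
  have e2 := Finset.sum_filter_add_sum_filter_not u (· ∈ t) fun i => ‖ρ i‖ / ‖z - μ i‖
  rw [← hu] at e1
  linarith

/-- An entire function `f` of exponential type with `1 = f(z) (1 + ∑ ρ_i / (z - μ_i))`, where the
`μ_i` are zeros of `f` and `ρ` is square summable, is constant. -/
theorem apply_eq_apply_of_partial_fractions {I : Type*} {μ ρ : I → ℂ} {f : ℂ → ℂ}
    (hf : Differentiable ℂ f) {A T P : ℝ} (hT : 0 ≤ T) (hA : ∀ z, ‖f z‖ ≤ Real.exp (T * ‖z‖) * A)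
    (hμ : Function.Injective μ) (hfin : ∀ R : ℝ, {i | ‖μ i‖ ≤ R}.Finite) (hfμ : ∀ i, f (μ i) = 0)
    (hρ : ∀ s : Finset I, ∑ i ∈ s, ‖ρ i‖ ^ 2 ≤ P)
    (hpf : ∀ z, f z ≠ 0 → HasSum (fun i => ρ i / (z - μ i)) ((f z)⁻¹ - 1))
    {z₀ : ℂ} (hz₀ : f z₀ ≠ 0) (z w : ℂ) : f z = f w := by
  classical
  obtain ⟨K, hK, hcount⟩ := exists_card_zeros_le hf hT hA hz₀
  refine hf.apply_eq_apply_of_bounded_on_circles (B := 2) (fun N => ?_) z w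
  -- With `ε = 1/6` the sum is at most `1/2`, so `|1/f - 1| ≤ 1/2` and `|f| ≤ 2` on the circle;
  -- zeros of `f` there are harmless.
  obtain ⟨R, hNR, hne, hR⟩ := exists_large_circle_sum_le (μ := μ) (ρ := ρ) (P := P) (K := K)
    (ε := 1 / 6) (z₀ := z₀) (by norm_num) hfin hρ
    (by simpa using (hpf z₀ hz₀).summable.norm)
    (fun i h => hz₀ (h ▸ hfμ i)) hK
    (fun R hR s hs => by
      have := hcount R hR (s.image μ) (by
        intro a ha
        obtain ⟨i, hi, rfl⟩ := Finset.mem_image.1 ha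
        exact ⟨hs i hi, hfμ i⟩)
      rwa [Finset.card_image_of_injective _ hμ] at this) N
  refine ⟨R, hNR, fun z hz => ?_⟩
  by_cases h0 : f z = 0
  · simp [h0]
  have h1 : ‖(f z)⁻¹ - 1‖ ≤ 1 / 2 := by
    refine le_of_tendsto (hpf z h0).norm (Eventually.of_forall fun s => ?_)
    calc _ ≤ ∑ i ∈ s, ‖ρ i‖ / ‖z - μ i‖ := by
          simpa using norm_sum_le s fun i => ρ i / (z - μ i)
      _ ≤ 3 * (1 / 6) := hR z hz s
      _ = 1 / 2 := by norm_num
  have h2 : 1 / 2 ≤ ‖(f z)⁻¹‖ := by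
    have := norm_sub_norm_le (1 : ℂ) (f z)⁻¹
    rw [norm_sub_rev, norm_one] at this
    linarith
  rw [norm_inv] at h2
  have := inv_anti₀ (by norm_num) h2
  simpa using this

/-! ### Moment problems for strongly minimal families. -/

/-- A strongly minimal family admits a solution of the moment problem for every square summable
right-hand side. -/
theorem exists_inner_eq_of_strongly_minimal {I E : Type*} [NormedAddCommGroup E]
    [InnerProductSpace ℂ E] [CompleteSpace E] {x : I → E} {γ : ℝ} (hγ : 0 < γ)
    (hx : ∀ (s : Finset I) (a : I → ℂ), γ * ∑ i ∈ s, ‖a i‖ ^ 2 ≤ ‖∑ i ∈ s, a i • x i‖ ^ 2)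
    {d : I → ℂ} {D : ℝ} (hD : 0 ≤ D) (hd : ∀ s : Finset I, ∑ i ∈ s, ‖d i‖ ^ 2 ≤ D ^ 2) :
    ∃ f : E, (∀ i, inner ℂ f (x i) = d i) ∧ ‖f‖ ≤ D / √γ := by
  have hli : LinearIndependent ℂ x := by
    rw [linearIndependent_iff]
    intro a ha
    rw [Finsupp.linearCombination_apply, Finsupp.sum] at ha
    have h1 := hx a.support a
    rw [ha, norm_zero] at h1
    ext i
    by_contra hi
    have h2 : ‖a i‖ ^ 2 ≤ ∑ i ∈ a.support, ‖a i‖ ^ 2 :=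
      Finset.single_le_sum (f := fun i => ‖a i‖ ^ 2) (fun _ _ => by positivity)
        (Finsupp.mem_support_iff.2 hi)
    have h3 : 0 < ‖a i‖ ^ 2 := by
      have : 0 < ‖a i‖ := norm_pos_iff.2 hi
      positivity
    nlinarith
  set p := Submodule.span ℂ (range x)
  -- The functional `∑ a i x i ↦ ∑ a i d i` is well defined by linear independence, and bounded by
  -- Cauchy–Schwarz and strong minimality. Hahn–Banach and Riesz representation then give `f`.
  let g : p →ₗ[ℂ] ℂ := (Finsupp.linearCombination ℂ d).comp hli.repr
  have hbound : ∀ y : p, ‖g y‖ ≤ D / √γ * ‖y‖ := by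
    intro y
    set a := hli.repr y with ha
    have hy : (y : E) = ∑ i ∈ a.support, a i • x i := by
      have := hli.linearCombination_repr y
      rw [← this, Finsupp.linearCombination_apply, Finsupp.sum]
    have hgy : g y = ∑ i ∈ a.support, a i * d i := by
      simp [g, Finsupp.linearCombination_apply, Finsupp.sum, ha]
    have h1 : ‖g y‖ ≤ ∑ i ∈ a.support, ‖a i‖ * ‖d i‖ := by
      rw [hgy]
      exact (norm_sum_le _ _).trans_eq (Finset.sum_congr rfl fun i _ => norm_mul _ _)
    have h2 := Finset.sum_mul_sq_le_sq_mul_sq a.support (fun i => ‖a i‖) (fun i => ‖d i‖)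
    have h3 := hx a.support a
    rw [← hy] at h3
    have h4 : (∑ i ∈ a.support, ‖a i‖ * ‖d i‖) ^ 2 ≤ (D / √γ * ‖y‖) ^ 2 := by
      have h5 : (D / √γ * ‖y‖) ^ 2 = (‖(y : E)‖ ^ 2 / γ) * D ^ 2 := by
        rw [mul_pow, div_pow, Real.sq_sqrt hγ.le, Submodule.coe_norm]; ring
      rw [h5]
      refine h2.trans ?_
      gcongr
      · rw [le_div_iff₀ hγ, mul_comm]; exact h3
      · exact hd _
    exact h1.trans (abs_le_of_sq_le_sq' h4 (by positivity)).2
  obtain ⟨ℓ, hℓ, hℓn⟩ := exists_extension_norm_eq p (g.mkContinuous (D / √γ) hbound)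
  refine ⟨(InnerProductSpace.toDual ℂ E).symm ℓ, fun i => ?_, ?_⟩
  · rw [InnerProductSpace.toDual_symm_apply]
    have h1 := hℓ ⟨x i, Submodule.subset_span (mem_range_self i)⟩
    rw [h1]
    simp [g, LinearIndependent.repr_eq_single hli i ⟨x i, _⟩ rfl]
  · rw [LinearIsometryEquiv.norm_map, hℓn]
    exact LinearMap.mkContinuous_norm_le _ (by positivity) _

/-- The inner product is conjugate linear in `f`, so it is the conjugate of `f` that solves the
moment problem written with `expTransform`. -/
theorem inner_expL2 {T : ℝ} (hT : 0 ≤ T) (f : Lp ℂ 2 (volIcc T)) (k lam : ℂ) :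
    inner ℂ f (expL2 T k lam) =
      k * expTransform T (fun t => starRingEnd ℂ (f t)) (-lam) := by
  rw [L2.inner_def, expTransform, ← intervalIntegral.integral_const_mul,
    intervalIntegral.integral_of_le hT, ← integral_Icc_eq_integral_Ioc]
  refine integral_congr_ae ?_
  filter_upwards [(memLp_mul_exp T k lam).coeFn_toLp] with t ht
  rw [expL2, ht, RCLike.inner_apply]
  ring

theorem MeasureTheory.Lp.memLp_conj {T : ℝ} (f : Lp ℂ 2 (volIcc T)) :
    MemLp (fun t => starRingEnd ℂ (f t)) 2 (volIcc T) :=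
  (Lp.memLp f).star

/-- Solvability of the moment problem for strongly minimal families of exponentials. -/
theorem exists_memLp_expTransform_eq {T : ℝ} (hT : 0 ≤ T) {I : Type*} {k lam : I → ℂ} {γ : ℝ}
    (hγ : 0 < γ)
    (hx : ∀ (s : Finset I) (a : I → ℂ), γ * ∑ i ∈ s, ‖a i‖ ^ 2 ≤
      ‖∑ i ∈ s, a i • expL2 T (k i) (lam i)‖ ^ 2)
    {d : I → ℂ} {D : ℝ} (hD : 0 ≤ D) (hd : ∀ s : Finset I, ∑ i ∈ s, ‖d i‖ ^ 2 ≤ D ^ 2) :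
    ∃ w : ℝ → ℂ, MemLp w 2 (volIcc T) ∧ (∀ i, k i * expTransform T w (-lam i) = d i) ∧
      ∀ z, ‖expTransform T w z‖ ≤ D / √γ * ‖expL2 T 1 (-z)‖ := by
  obtain ⟨f, hf, hfn⟩ := exists_inner_eq_of_strongly_minimal hγ hx hD hd
  refine ⟨_, Lp.memLp_conj f, fun i => ?_, fun z => ?_⟩
  · rw [← inner_expL2 hT, hf]
  · have h := inner_expL2 hT f 1 (-z)
    rw [one_mul, neg_neg] at h
    rw [← h]
    exact (norm_inner_le_norm _ _).trans (by gcongr)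

theorem expTransform_finsetSum {T : ℝ} {I : Type*} (s : Finset I) {w : I → ℝ → ℂ}
    (h : ∀ i ∈ s, IntervalIntegrable (w i) volume 0 T) (z : ℂ) :
    expTransform T (fun t => ∑ i ∈ s, w i t) z = ∑ i ∈ s, expTransform T (w i) z := by
  simp only [expTransform, Finset.mul_sum]
  exact intervalIntegral.integral_finsetSum fun i hi => intervalIntegrable_exp_mul (h i hi) z

/-- If a family of exponentials `c_i e^{μ_i t}` is strongly minimal and `c_i (1 + |μ_i|)` is square
summable, then the function `t` does not belong to the closed span of the family. -/
theorem exists_annihilator_moment_ne_zero {T : ℝ} (hT : 0 ≤ T) {I : Type*} {c μ : I → ℂ} {γ B : ℝ}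
    (hγ : 0 < γ) (hB : 0 ≤ B)
    (hx : ∀ (s : Finset I) (a : I → ℂ), γ * ∑ i ∈ s, ‖a i‖ ^ 2 ≤
      ‖∑ i ∈ s, a i • expL2 T (c i) (-μ i)‖ ^ 2)
    (hμ : Function.Injective μ) (hfin : ∀ R : ℝ, {i | ‖μ i‖ ≤ R}.Finite) {i₀ : I} (hi₀ : μ i₀ = 0)
    (hc : ∀ s : Finset I, ∑ i ∈ s, (‖c i‖ * (1 + ‖μ i‖)) ^ 2 ≤ B ^ 2) :
    ∃ w : ℝ → ℂ, MemLp w 2 (volIcc T) ∧ (∀ i, expTransform T w (μ i) = 0) ∧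
      ∫ t in (0 : ℝ)..T, (t : ℂ) * w t ≠ 0 := by
  classical
  by_contra! hcon
  -- Under the contrary assumption every annihilator has zero first moment, so it has zero transform
  -- by repeated division by `z`.
  have huniq : ∀ w : ℝ → ℂ, MemLp w 2 (volIcc T) → (∀ i, expTransform T w (μ i) = 0) →
      ∀ z, expTransform T w z = 0 := by
    intro w hw hwμ z
    refine expTransform_eq_zero_of_forall_moment hT (Z := range μ) ⟨i₀, hi₀⟩ ?_ hw ?_ z
    · exact fun w hw h => hcon w hw fun i => h _ (mem_range_self i)
    · rintro _ ⟨i, rfl⟩; exact hwμ i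
  have hii : ∀ {w : ℝ → ℂ}, MemLp w 2 (volIcc T) → IntervalIntegrable w volume 0 T :=
    fun hw => intervalIntegrable_of_memLp_volIcc hT hw
  have hc0 : ∀ i, c i ≠ 0 := by
    intro i h0
    have h1 := hx {i} (fun _ => 1)
    have h2 : expL2 T (c i) (-μ i) = 0 := by
      rw [h0, Lp.eq_zero_iff_ae_eq_zero]
      filter_upwards [(memLp_mul_exp T 0 (-μ i)).coeFn_toLp] with t ht
      rw [expL2, ht]; simp
    simp [h2] at h1
    linarith
  have hcB : ∀ s : Finset I, ∑ i ∈ s, ‖c i‖ ^ 2 ≤ B ^ 2 := fun s =>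
    (Finset.sum_le_sum fun i _ => by
      have : ‖c i‖ * 1 ≤ ‖c i‖ * (1 + ‖μ i‖) := by gcongr; linarith [norm_nonneg (μ i)]
      rw [mul_one] at this
      gcongr).trans (hc s)
  have hmoment : ∀ (d : I → ℂ) (D : ℝ), 0 ≤ D → (∀ s : Finset I, ∑ i ∈ s, ‖d i‖ ^ 2 ≤ D ^ 2) →
      ∃ w : ℝ → ℂ, MemLp w 2 (volIcc T) ∧ (∀ i, c i * expTransform T w (μ i) = d i) ∧
        ∀ z, ‖expTransform T w z‖ ≤ D / √γ * ‖expL2 T 1 (-z)‖ := by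
    intro d D hD hd
    simpa using exists_memLp_expTransform_eq hT hγ hx hD hd
  -- The data `-c i` are square summable and force `ŵb(μ i) = -1`, so `Δ = 1 + ŵb` vanishes at every
  -- `μ i`.
  obtain ⟨wb, hwb, hwbm, -⟩ := hmoment (fun i => -c i) B hB (by simpa using hcB)
  have hwbμ : ∀ i, 1 + expTransform T wb (μ i) = 0 := fun i => by
    have := hwbm i
    have h2 : c i * (1 + expTransform T wb (μ i)) = 0 := by linear_combination this
    exact (mul_eq_zero.1 h2).resolve_left (hc0 i)
  set Δ : ℂ → ℂ := fun z => 1 + expTransform T wb z with hΔ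
  obtain ⟨z₀, hz₀⟩ : ∃ z₀, Δ z₀ ≠ 0 := by
    by_contra! h
    have h1 := (tendsto_expTransform_neg_atTop hT (hii hwb)).const_add 1
    have h2 : Tendsto (fun x : ℝ => 1 + expTransform T wb (-(x : ℂ))) atTop (𝓝 0) :=
      tendsto_const_nhds.congr fun x => (h _).symm
    simpa using tendsto_nhds_unique h1 h2
  have hbi : ∀ i, ∃ w : ℝ → ℂ, MemLp w 2 (volIcc T) ∧
      (∀ j, c j * expTransform T w (μ j) = if j = i then 1 else 0) ∧
        ∀ z, ‖expTransform T w z‖ ≤ 1 / √γ * ‖expL2 T 1 (-z)‖ := fun i => by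
    refine hmoment (fun j => if j = i then 1 else 0) 1 zero_le_one fun s => ?_
    have : ∀ j, ‖(if j = i then (1 : ℂ) else 0)‖ ^ 2 = if j = i then (1 : ℝ) else 0 := by
      intro j; split_ifs <;> simp
    simp only [this, Finset.sum_ite_eq']
    split_ifs <;> simp
  choose w hw hwm hwn using hbi
  -- `Δ(z)/(z - μ i)` is a transform vanishing at all `μ j` with `j ≠ i`. By `huniq` it is a
  -- multiple of the biorthogonal transform; the multiple is nonzero because `Δ z₀ ≠ 0`.
  have hρ : ∀ i, ∃ ρ : ℂ, ∀ z, (z - μ i) * (c i * expTransform T (w i) z) = ρ * Δ z := by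
    intro i
    obtain ⟨f, hf, hfz⟩ := exists_expTransform_mul_sub_eq hT (hii hwb) 1 (μ i) (hwbμ i)
    set κ := expTransform T f (μ i) with hκ
    have hf2 := hf.memLp_volIcc
    have hzero : ∀ z, expTransform T f z = κ * c i * expTransform T (w i) z := by
      intro z
      have h1 := huniq (fun t => f t + (-(κ * c i)) * w i t) (hf2.add ((hw i).const_mul _))
        (fun j => by
          rw [expTransform_add (hii hf2) (hii ((hw i).const_mul _)), expTransform_const_mul]
          by_cases hj : j = i
          · subst hj
            have := hwm j j
            rw [if_pos rfl] at this
            linear_combination (-κ) * this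
          · have h2 := hwm i j
            rw [if_neg hj] at h2
            have h3 := (mul_eq_zero.1 h2).resolve_left (hc0 j)
            have h4 := hfz (μ j)
            rw [hwbμ j] at h4
            have h5 := (mul_eq_zero.1 h4).resolve_left (sub_ne_zero.2 fun h => hj (hμ h))
            rw [h3, h5]; ring) z
      rw [expTransform_add (hii hf2) (hii ((hw i).const_mul _)), expTransform_const_mul] at h1
      linear_combination h1
    have hκ0 : κ ≠ 0 := by
      intro h0
      apply hz₀
      rw [hΔ]
      simp only
      rw [← hfz, hzero, h0]; ring
    refine ⟨κ⁻¹, fun z => ?_⟩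
    rw [eq_inv_mul_iff_mul_eq₀ hκ0, hΔ]
    simp only
    rw [← hfz, hzero]; ring
  choose ρ hρ using hρ
  -- The error of a partial sum over `s` has moments `-c i` off `s` and `0` on `s`. By `huniq` its
  -- transform is that of the moment solution for these data, which is small because the tail of `∑
  -- ‖c i‖²` is small.
  have hexp : ∀ z, HasSum (fun i => c i * expTransform T (w i) z) (1 - Δ z) := by
    intro z
    have hsum2 : Summable fun i => ‖c i‖ ^ 2 := summable_of_sum_le (fun i => by positivity) hcB
    -- The summand `1` keeps `b` positive and makes the final bound `(ε/b)(b - 1)` strictly less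
    -- than `ε`.
    set b : ℝ := ‖expL2 T 1 (-z)‖ / √γ + 1 with hb
    have hb0 : 0 < b := by positivity
    rw [HasSum, SummationFilter.unconditional_filter, Metric.tendsto_atTop]
    intro ε hε
    obtain ⟨s₀, hs₀⟩ := (summable_iff_vanishing_norm.1 hsum2) ((ε / b) ^ 2) (by positivity)
    refine ⟨s₀, fun s hs => ?_⟩
    obtain ⟨w', hw', hw'm, hw'n⟩ := hmoment (fun i => if i ∈ s then 0 else -c i) (ε / b)
      (by positivity) (fun t => by
        have h1 : ∑ i ∈ t, ‖(if i ∈ s then (0 : ℂ) else -c i)‖ ^ 2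
            = ∑ i ∈ t.filter (· ∉ s), ‖c i‖ ^ 2 := by
          rw [Finset.sum_filter]
          refine Finset.sum_congr rfl fun i _ => ?_
          split_ifs <;> simp_all
        rw [h1]
        refine (le_abs_self _).trans (hs₀ _ ?_).le
        rw [Finset.disjoint_left]
        intro i hi his
        exact (Finset.mem_filter.1 hi).2 (hs his))
    have hS2 : MemLp (fun t => ∑ i ∈ s, c i * w i t) 2 (volIcc T) :=
      memLp_finsetSum s fun i _ => (hw i).const_mul (c i)
    have hSz : ∀ z, expTransform T (fun t => ∑ i ∈ s, c i * w i t) z =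
        ∑ i ∈ s, c i * expTransform T (w i) z := fun z => by
      rw [expTransform_finsetSum s fun i _ => hii ((hw i).const_mul (c i))]
      exact Finset.sum_congr rfl fun i _ => expTransform_const_mul _ _ _ _
    have hw'' : MemLp (fun t => (-1) * w' t) 2 (volIcc T) := hw'.const_mul _
    have h1 := huniq (fun t => (wb t + ∑ i ∈ s, c i * w i t) + (-1) * w' t)
      ((hwb.add hS2).add hw'') (fun j => by
        rw [expTransform_add ((hii hwb).add (hii hS2)) (hii hw''),
          expTransform_add (hii hwb) (hii hS2), hSz, expTransform_const_mul]
        have h2 : c j * (expTransform T wb (μ j) + ∑ i ∈ s, c i * expTransform T (w i) (μ j) +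
            -1 * expTransform T w' (μ j)) = 0 := by
          have h3 : c j * ∑ i ∈ s, c i * expTransform T (w i) (μ j) = if j ∈ s then c j else 0 := by
            have h4 : ∀ i, c j * (c i * expTransform T (w i) (μ j)) =
                if j = i then c i else 0 := fun i => by
              rw [mul_left_comm, hwm i j]; split_ifs <;> simp
            rw [Finset.mul_sum]
            simp only [h4, Finset.sum_ite_eq]
          have h5 := hw'm j
          have h6 := hwbm j
          rw [mul_add, mul_add, h3, h6]
          split_ifs at h5 ⊢ with hj
          · linear_combination -h5
          · linear_combination -h5
        exact (mul_eq_zero.1 h2).resolve_left (hc0 j)) z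
    rw [expTransform_add ((hii hwb).add (hii hS2)) (hii hw''),
      expTransform_add (hii hwb) (hii hS2), hSz, expTransform_const_mul] at h1
    have h7 : (∑ i ∈ s, c i * expTransform T (w i) z) - (1 - Δ z) = expTransform T w' z := by
      rw [hΔ]; simp only; linear_combination h1
    rw [dist_eq_norm, h7]
    refine (hw'n z).trans_lt ?_
    have h8 : ε / b / √γ * ‖expL2 T 1 (-z)‖ = ε / b * (b - 1) := by rw [hb]; ring
    rw [h8, div_mul_eq_mul_div, div_lt_iff₀ hb0]
    nlinarith
  have hΔd : Differentiable ℂ Δ := (differentiable_expTransform hT (hii hwb)).const_add 1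
  set C : ℝ := (1 + ‖z₀‖) * (1 / √γ * ‖expL2 T 1 (-z₀)‖) / ‖Δ z₀‖ with hC
  have hz₀n : 0 < ‖Δ z₀‖ := norm_pos_iff.2 hz₀
  -- Evaluating the identity for `ρ i` at `z₀` costs the factor `‖z₀ - μ i‖`; this is why `c i (1 +
  -- ‖μ i‖)` must be square summable.
  have hρn : ∀ i, ‖ρ i‖ ≤ C * (‖c i‖ * (1 + ‖μ i‖)) := fun i => by
    have h1 := congrArg norm (hρ i z₀)
    rw [norm_mul, norm_mul, norm_mul] at h1
    have h2 : ‖z₀ - μ i‖ ≤ (1 + ‖z₀‖) * (1 + ‖μ i‖) :=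
      (norm_sub_le _ _).trans (by nlinarith [norm_nonneg z₀, norm_nonneg (μ i)])
    have h3 : ‖ρ i‖ * ‖Δ z₀‖ ≤
        (1 + ‖z₀‖) * (1 + ‖μ i‖) * (‖c i‖ * (1 / √γ * ‖expL2 T 1 (-z₀)‖)) := by
      rw [← h1]
      gcongr
      exact hwn i z₀
    rw [← le_div_iff₀ hz₀n] at h3
    refine h3.trans_eq ?_
    rw [hC]; ring
  have hconst := apply_eq_apply_of_partial_fractions (μ := μ) (ρ := ρ) (f := Δ)
    (A := 1 + ∫ t in (0 : ℝ)..T, ‖wb t‖) (P := C ^ 2 * B ^ 2) hΔd hT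
    (fun z => by
      have h1 := norm_expTransform_le hT (hii hwb) z
      have h2 : 1 ≤ Real.exp (T * ‖z‖) := Real.one_le_exp (by positivity)
      calc ‖Δ z‖ ≤ ‖(1 : ℂ)‖ + ‖expTransform T wb z‖ := norm_add_le _ _
        _ ≤ _ := by rw [norm_one, mul_add, mul_one]; linarith)
    hμ hfin hwbμ
    (fun s => by
      calc ∑ i ∈ s, ‖ρ i‖ ^ 2 ≤ ∑ i ∈ s, C ^ 2 * (‖c i‖ * (1 + ‖μ i‖)) ^ 2 := by
            refine Finset.sum_le_sum fun i _ => ?_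
            rw [← mul_pow]
            gcongr
            exact hρn i
        _ = C ^ 2 * ∑ i ∈ s, (‖c i‖ * (1 + ‖μ i‖)) ^ 2 := by rw [Finset.mul_sum]
        _ ≤ _ := by gcongr; exact hc s)
    (fun z hz => by
      have h1 := (hexp z).div_const (Δ z)
      have h2 : (1 - Δ z) / Δ z = (Δ z)⁻¹ - 1 := by field_simp
      rw [h2] at h1
      refine h1.congr_fun fun i => ?_
      have hne : z - μ i ≠ 0 := sub_ne_zero.2 fun h => hz (h ▸ hwbμ i)
      rw [div_eq_div_iff hne hz, ← hρ i z]; ring)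
    hz₀ z₀ (μ i₀)
  exact hz₀ (hconst.trans (hwbμ i₀))

/-! ### Semigroups, generators and their adjoints. -/

namespace C0Semigroup

variable {X : Type*} [NormedAddCommGroup X] [NormedSpace ℂ X]

/-- The orbit of `x`, extended by the constant `x` to negative times. -/
noncomputable def orbit (S : C0Semigroup X) (x : X) (t : ℝ) : X := S.op (max t 0) x

theorem continuous_orbit (S : C0Semigroup X) (x : X) : Continuous (S.orbit x) :=
  (S.continuousOn_orbit x).comp_continuous (by fun_prop) fun t => le_max_right t 0

theorem orbit_of_nonneg (S : C0Semigroup X) (x : X) {t : ℝ} (ht : 0 ≤ t) :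
    S.orbit x t = S.op t x := by rw [orbit, max_eq_left ht]

theorem orbit_zero (S : C0Semigroup X) (x : X) : S.orbit x 0 = x := by
  rw [S.orbit_of_nonneg x le_rfl, S.op_zero]; rfl

theorem op_orbit (S : C0Semigroup X) (x : X) {s t : ℝ} (hs : 0 ≤ s) (ht : 0 ≤ t) :
    S.op s (S.orbit x t) = S.orbit x (s + t) := by
  rw [S.orbit_of_nonneg x ht, S.orbit_of_nonneg x (add_nonneg hs ht), S.op_add s t hs ht]; rfl

theorem intervalIntegrable_smul_op (S : C0Semigroup X) (b : X) {t : ℝ} (ht : 0 ≤ t)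
    {v : ℝ → ℂ} (hv : IntervalIntegrable v volume 0 t) :
    IntervalIntegrable (fun τ => v τ • S.op (t - τ) b) volume 0 t := by
  refine (intervalIntegrable_congr fun τ hτ => ?_).1 (hv.smul_continuousOn
    (g := fun τ => S.orbit b (t - τ)) ((S.continuous_orbit b).comp (by fun_prop)).continuousOn)
  rw [uIoc_of_le ht] at hτ
  rw [S.orbit_of_nonneg b (sub_nonneg.2 hτ.2)]

theorem hasDerivWithinAt_orbit {S : C0Semigroup X} {A : X →ₗ.[ℂ] X} (hS : S.HasGenerator A)
    {x y : X} (hxy : (x, y) ∈ A.graph) {t : ℝ} (ht : 0 ≤ t) :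
    HasDerivWithinAt (S.orbit x) (S.op t y) (Ici t) t := by
  rw [← hasDerivWithinAt_Ioi_iff_Ici, hasDerivWithinAt_iff_tendsto_slope' self_notMem_Ioi]
  have h1 : Tendsto (fun s : ℝ => s - t) (𝓝[>] t) (𝓝[>] 0) := by
    refine tendsto_nhdsWithin_iff.2 ⟨?_, ?_⟩
    · have : Tendsto (fun s : ℝ => s - t) (𝓝 t) (𝓝 (t - t)) := tendsto_id.sub_const t
      rw [sub_self] at this
      exact this.mono_left nhdsWithin_le_nhds
    · filter_upwards [self_mem_nhdsWithin] with s hs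
      exact sub_pos.2 (show t < s from hs)
  refine (((S.op t).continuous.tendsto y).comp (((hS x y).1 hxy).comp h1)).congr' ?_
  filter_upwards [self_mem_nhdsWithin] with s hs
  have hs' : t < s := hs
  have e : S.op t (S.op (s - t) x) = S.orbit x s := by
    have := S.op_orbit x ht (sub_pos.2 hs').le
    rwa [S.orbit_of_nonneg x (sub_pos.2 hs').le, add_sub_cancel] at this
  simp only [Function.comp_apply, map_smul, map_sub, e, slope, vsub_eq_sub]
  rw [S.orbit_of_nonneg x ht, ← Complex.ofReal_inv, Complex.coe_smul]

/-- The semigroup acts on an eigenvector of its generator by an exponential. -/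
theorem op_eq_exp_smul {S : C0Semigroup X} {A : X →ₗ.[ℂ] X} (hS : S.HasGenerator A)
    {x : X} {lam : ℂ} (hx : (x, lam • x) ∈ A.graph) {t : ℝ} (ht : 0 ≤ t) :
    S.op t x = Complex.exp (lam * t) • x := by
  -- `e^{-λs} S(s)x` is continuous with zero right derivative, hence constant; the generator
  -- directly controls right derivatives only.
  have hconst := constant_of_has_deriv_right_zero (a := 0) (b := t)
    (f := fun s : ℝ => Complex.exp (-lam * s) • S.orbit x s)
    ((by fun_prop : Continuous fun s : ℝ => Complex.exp (-lam * s)).smul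
      (S.continuous_orbit x)).continuousOn
    (fun s hs => by
      have h1 : HasDerivAt (fun s : ℝ => Complex.exp (-lam * s))
          (Complex.exp (-lam * s) * (-lam * 1)) s :=
        ((HasDerivAt.ofReal_comp (hasDerivAt_id s)).const_mul (-lam)).cexp
      have h2 := h1.hasDerivWithinAt.smul (hasDerivWithinAt_orbit hS hx hs.1)
      have h3 : Complex.exp (-lam * s) • S.op s (lam • x) +
          (Complex.exp (-lam * s) * (-lam * 1)) • S.orbit x s = 0 := by
        rw [S.orbit_of_nonneg x hs.1, map_smul, smul_smul, ← add_smul]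
        ring_nf
        exact zero_smul _ _
      exact h3 ▸ h2) t (right_mem_Icc.2 ht)
  simp only [Complex.ofReal_zero, mul_zero, Complex.exp_zero, one_smul, S.orbit_zero,
    S.orbit_of_nonneg x ht] at hconst
  calc S.op t x = Complex.exp (lam * t) • Complex.exp (-lam * t) • S.op t x := by
        rw [smul_smul, ← Complex.exp_add]; simp
    _ = _ := by rw [hconst]

variable [CompleteSpace X]

/-- The integral of an orbit belongs to the domain of the generator. -/
theorem integral_orbit_mem_graph {S : C0Semigroup X} {A : X →ₗ.[ℂ] X} (hS : S.HasGenerator A)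
    (x : X) {t : ℝ} (ht : 0 ≤ t) :
    (∫ s in (0 : ℝ)..t, S.orbit x s, S.op t x - x) ∈ A.graph := by
  rw [hS]
  have hc := S.continuous_orbit x
  have hint : ∀ a b, IntervalIntegrable (S.orbit x) volume a b := fun a b =>
    hc.intervalIntegrable a b
  set P : ℝ → X := fun u => ∫ s in (0 : ℝ)..u, S.orbit x s with hP
  have hPd : ∀ u, HasDerivAt P (S.orbit x u) u := fun u =>
    intervalIntegral.integral_hasDerivAt_right (hint 0 u)
      hc.aestronglyMeasurable.stronglyMeasurableAtFilter hc.continuousAt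
  -- By the semigroup law `S(ε) P(t) = P(t + ε) - P(ε)`, so the quotient defining the generator is a
  -- difference quotient of this function.
  have hQ : HasDerivAt (fun ε => P (t + ε) - P ε) (S.op t x - x) 0 := by
    have h1 : HasDerivAt (fun ε => P (t + ε)) (S.orbit x t) 0 := by
      have := hPd (t + 0)
      have h2 := HasDerivAt.scomp (0 : ℝ) this ((hasDerivAt_id (0 : ℝ)).const_add t)
      simp only [add_zero, one_smul] at h2
      exact h2
    have h2 := h1.sub (hPd 0)
    rwa [S.orbit_zero, S.orbit_of_nonneg x ht] at h2
  have hs := (hasDerivAt_iff_tendsto_slope.1 hQ).mono_left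
    (nhdsWithin_mono (0 : ℝ) (fun y (hy : 0 < y) => hy.ne') : 𝓝[>] (0 : ℝ) ≤ 𝓝[≠] 0)
  refine hs.congr' ?_
  filter_upwards [self_mem_nhdsWithin] with ε hε
  have hε' : (0 : ℝ) < ε := hε
  have e1 : S.op ε (P t) = P (t + ε) - P ε := by
    rw [hP]
    simp only
    rw [← ContinuousLinearMap.intervalIntegral_comp_comm _ (hint 0 t),
      intervalIntegral.integral_interval_sub_left (hint _ _) (hint _ _)]
    have e2 : ∫ s in (0 : ℝ)..t, S.op ε (S.orbit x s) = ∫ s in (0 : ℝ)..t, S.orbit x (ε + s) := by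
      refine intervalIntegral.integral_congr fun s hs => ?_
      rw [uIcc_of_le ht] at hs
      exact S.op_orbit x hε'.le hs.1
    rw [e2, intervalIntegral.integral_comp_add_left (fun s => S.orbit x s)]
    simp [add_comm]
  have e3 : P 0 = 0 := by simp [hP]
  change _ = ((ε : ℂ)⁻¹) • (S.op ε (P t) - P t)
  simp only [slope, vsub_eq_sub, e1, add_zero, e3, sub_zero]
  rw [← Complex.ofReal_inv, Complex.coe_smul]

/-- The averages of an orbit over `[0, t]` lie in the domain and tend to `x`. Density is what makes
the adjoint of `A` a formal adjoint. -/
theorem dense_domain {S : C0Semigroup X} {A : X →ₗ.[ℂ] X} (hS : S.HasGenerator A) :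
    Dense (A.domain : Set X) := by
  intro x
  have hc := S.continuous_orbit x
  have hd : HasDerivAt (fun u => ∫ s in (0 : ℝ)..u, S.orbit x s) (S.orbit x 0) 0 :=
    intervalIntegral.integral_hasDerivAt_right (hc.intervalIntegrable 0 0)
      hc.aestronglyMeasurable.stronglyMeasurableAtFilter hc.continuousAt
  have hs := (hasDerivAt_iff_tendsto_slope.1 hd).mono_left
    (nhdsWithin_mono (0 : ℝ) (fun y (hy : 0 < y) => hy.ne') : 𝓝[>] (0 : ℝ) ≤ 𝓝[≠] 0)
  rw [S.orbit_zero] at hs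
  refine mem_closure_of_tendsto hs ?_
  filter_upwards [self_mem_nhdsWithin] with t ht
  have hmem := LinearPMap.mem_domain_of_mem_graph (integral_orbit_mem_graph hS x (le_of_lt ht))
  have : slope (fun u => ∫ s in (0 : ℝ)..u, S.orbit x s) 0 t =
      ((t : ℂ)⁻¹) • ∫ s in (0 : ℝ)..t, S.orbit x s := by
    rw [← Complex.ofReal_inv, Complex.coe_smul]
    simp [slope]
  rw [this]
  exact A.domain.smul_mem _ hmem

end C0Semigroup

/-- For `c ∈ D(A*)` the function `t ↦ (c, S(t) x)` is the primitive of `(A* c, S(t) x)`. -/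
theorem C0Semigroup.inner_op_eq_add_integral {X : Type*} [NormedAddCommGroup X]
    [InnerProductSpace ℂ X] [CompleteSpace X] {S : C0Semigroup X} {A : X →ₗ.[ℂ] X}
    (hS : S.HasGenerator A) {c : X} (hc : c ∈ A.adjoint.domain) (x : X) {t : ℝ} (ht : 0 ≤ t) :
    inner ℂ c (S.op t x) =
      inner ℂ c x + ∫ s in (0 : ℝ)..t, inner ℂ (A.adjoint ⟨c, hc⟩) (S.orbit x s) := by
  obtain ⟨y, hy, hAy⟩ := LinearPMap.mem_graph_iff _ |>.1 (S.integral_orbit_mem_graph hS x ht)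
  have h1 := A.adjoint_isFormalAdjoint (S.dense_domain hS) ⟨c, hc⟩ y
  simp only at hy hAy
  rw [hAy, hy, inner_sub_right] at h1
  have h2 := ContinuousLinearMap.intervalIntegral_comp_comm (innerSL ℂ (A.adjoint ⟨c, hc⟩))
    ((S.continuous_orbit x).intervalIntegrable (μ := volume) 0 t)
  simp only [innerSL_apply_apply] at h2
  rw [h2, h1]
  ring

/-! ### Riesz bases and modal coefficients of mild solutions. -/

section Riesz

variable {J X : Type*} [NormedAddCommGroup X] [InnerProductSpace ℂ X] {φ ψ : J → X}

theorem inner_sum_smul_of_biorthogonal (h1 : ∀ j, inner ℂ (ψ j) (φ j) = 1)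
    (h0 : ∀ i j, i ≠ j → inner ℂ (ψ i) (φ j) = 0) (a : J →₀ ℂ) (i : J) :
    inner ℂ (ψ i) (Finsupp.linearCombination ℂ φ a) = a i := by
  classical
  rw [Finsupp.linearCombination_apply, Finsupp.sum, inner_sum]
  have : ∀ j, inner ℂ (ψ i) (a j • φ j) = if i = j then a j else 0 := fun j => by
    rw [inner_smul_right]
    split_ifs with h
    · rw [h, h1, mul_one]
    · rw [h0 i j h, mul_zero]
  simp only [this, Finset.sum_ite_eq]
  split_ifs with h
  · rfl
  · exact (Finsupp.notMem_support_iff.1 h).symm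

theorem IsRieszBasis.dense_span (hφ : IsRieszBasis φ) :
    Dense (Submodule.span ℂ (range φ) : Set X) := dense_iff_closure_eq.2 hφ.1

/-- Bessel's inequality for the biorthogonal system of a Riesz basis. -/
theorem IsRieszBasis.exists_bessel (hφ : IsRieszBasis φ) (h1 : ∀ j, inner ℂ (ψ j) (φ j) = 1)
    (h0 : ∀ i j, i ≠ j → inner ℂ (ψ i) (φ j) = 0) :
    ∃ m : ℝ, 0 < m ∧ ∀ (s : Finset J) (x : X), m * ∑ j ∈ s, ‖inner ℂ (ψ j) x‖ ^ 2 ≤ ‖x‖ ^ 2 := by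
  classical
  obtain ⟨m, M, hm, -, h⟩ := hφ.2
  refine ⟨m, hm, fun s x => ?_⟩
  refine hφ.dense_span.induction (P := fun x => m * ∑ j ∈ s, ‖inner ℂ (ψ j) x‖ ^ 2 ≤ ‖x‖ ^ 2)
    (fun x hx => ?_) (isClosed_le (by fun_prop) (by fun_prop)) x
  obtain ⟨a, rfl⟩ := (Finsupp.mem_span_range_iff_exists_finsupp).1 hx
  change m * ∑ j ∈ s, ‖inner ℂ (ψ j) (Finsupp.linearCombination ℂ φ a)‖ ^ 2 ≤ _
  simp only [inner_sum_smul_of_biorthogonal h1 h0]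
  have h2 : ∑ j ∈ s, ‖a j‖ ^ 2 ≤ ∑ j ∈ a.support, ‖a j‖ ^ 2 := by
    calc _ ≤ ∑ j ∈ s ∪ a.support, ‖a j‖ ^ 2 :=
          Finset.sum_le_sum_of_subset_of_nonneg Finset.subset_union_left fun _ _ _ => by positivity
      _ = _ := (Finset.sum_subset Finset.subset_union_right fun j _ hj => by
          simp [Finsupp.notMem_support_iff.1 hj]).symm
  exact (mul_le_mul_of_nonneg_left h2 hm.le).trans (h a.support a).1

/-- The biorthogonal system of a Riesz basis is total. -/
theorem IsRieszBasis.eq_zero_of_forall_inner (hφ : IsRieszBasis φ)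
    (h1 : ∀ j, inner ℂ (ψ j) (φ j) = 1) (h0 : ∀ i j, i ≠ j → inner ℂ (ψ i) (φ j) = 0) {x : X}
    (hx : ∀ j, inner ℂ (ψ j) x = 0) : x = 0 := by
  obtain ⟨m', hm', hb⟩ := hφ.exists_bessel h1 h0
  obtain ⟨m, M, hm, hM, h⟩ := hφ.2
  -- Since all coefficients of `x` vanish, `y` and `y - x` have the same ones: for `y` in the span,
  -- the upper Riesz bound applies to `y` and Bessel to `y - x`. Taking `y = x` gives the claim.
  have key : ∀ y : X, m' * ‖y‖ ^ 2 ≤ M * ‖y - x‖ ^ 2 := by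
    intro y
    refine hφ.dense_span.induction (P := fun y => m' * ‖y‖ ^ 2 ≤ M * ‖y - x‖ ^ 2)
      (fun y hy => ?_) (isClosed_le (by fun_prop) (by fun_prop)) y
    obtain ⟨a, rfl⟩ := (Finsupp.mem_span_range_iff_exists_finsupp).1 hy
    have h2 := hb a.support (Finsupp.linearCombination ℂ φ a - x)
    simp only [inner_sub_right, hx, sub_zero, inner_sum_smul_of_biorthogonal h1 h0] at h2
    have h3 := (h a.support a).2
    change m' * ‖∑ j ∈ a.support, a j • φ j‖ ^ 2 ≤
      M * ‖Finsupp.linearCombination ℂ φ a - x‖ ^ 2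
    calc _ ≤ m' * (M * ∑ j ∈ a.support, ‖a j‖ ^ 2) := by gcongr
      _ = M * (m' * ∑ j ∈ a.support, ‖a j‖ ^ 2) := by ring
      _ ≤ _ := by gcongr
  have h2 := key x
  rw [sub_self, norm_zero] at h2
  by_contra hne
  have : 0 < ‖x‖ ^ 2 := by have := norm_pos_iff.2 hne; positivity
  nlinarith

end Riesz

section Coefficients

variable {J X : Type*} [NormedAddCommGroup X] [InnerProductSpace ℂ X] {φ ψ : J → X}
  {S : C0Semigroup X} {A : X →ₗ.[ℂ] X} {lam : J → ℂ}

/-- On each eigenvector `φ i` this is biorthogonality; linearity and density of the span give the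
rest. -/
theorem inner_op_of_biorthogonal (hS : S.HasGenerator A)
    (hA : ∀ j, (φ j, lam j • φ j) ∈ A.graph) (hφ : IsRieszBasis φ)
    (h0 : ∀ i j, i ≠ j → inner ℂ (ψ i) (φ j) = 0) (j : J) {t : ℝ} (ht : 0 ≤ t) (x : X) :
    inner ℂ (ψ j) (S.op t x) = Complex.exp (lam j * t) * inner ℂ (ψ j) x := by
  refine hφ.dense_span.induction
    (P := fun x => inner ℂ (ψ j) (S.op t x) = Complex.exp (lam j * t) * inner ℂ (ψ j) x)
    (fun x hx => ?_) (isClosed_eq (by fun_prop) (by fun_prop)) x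
  induction hx using Submodule.span_induction with
  | mem x hx =>
    obtain ⟨i, rfl⟩ := hx
    rw [C0Semigroup.op_eq_exp_smul hS (hA i) ht, inner_smul_right]
    by_cases hij : j = i
    · rw [hij]
    · rw [h0 j i hij]; simp
  | zero => simp
  | add x y _ _ hx hy => rw [map_add, inner_add_right, inner_add_right, hx, hy, mul_add]
  | smul a x _ hx => rw [map_smul, inner_smul_right, inner_smul_right, hx]; ring

variable [CompleteSpace X]

theorem inner_mildSolution (hS : S.HasGenerator A)
    (hA : ∀ j, (φ j, lam j • φ j) ∈ A.graph) (hφ : IsRieszBasis φ)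
    (h0 : ∀ i j, i ≠ j → inner ℂ (ψ i) (φ j) = 0) (j : J) {T : ℝ} (hT : 0 ≤ T) (b x : X)
    {v : ℝ → ℂ} (hv : IntervalIntegrable v volume 0 T) :
    inner ℂ (ψ j) (mildSolution S b x v T) = Complex.exp (lam j * T) *
      (inner ℂ (ψ j) x + inner ℂ (ψ j) b * expTransform T v (-lam j)) := by
  have hint := S.intervalIntegrable_smul_op b hT hv
  rw [mildSolution, inner_add_right, inner_op_of_biorthogonal hS hA hφ h0 j hT]
  have h2 := ContinuousLinearMap.intervalIntegral_comp_comm (innerSL ℂ (ψ j)) hint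
  simp only [innerSL_apply_apply] at h2
  rw [← h2, mul_add, expTransform, ← intervalIntegral.integral_const_mul,
    ← intervalIntegral.integral_const_mul]
  congr 1
  refine intervalIntegral.integral_congr fun τ hτ => ?_
  rw [uIcc_of_le hT] at hτ
  rw [inner_smul_right, inner_op_of_biorthogonal hS hA hφ h0 j (sub_nonneg.2 hτ.2)]
  push_cast
  rw [show lam j * ((T : ℂ) - τ) = lam j * T + -lam j * τ by ring, Complex.exp_add]
  ring

end Coefficients

/-! ### Reduction of null-controllability to a moment problem. -/

theorem memH1_primitive {T : ℝ} (hT : 0 ≤ T) {w : ℝ → ℂ} (hw : MemLp w 2 (volIcc T)) {α β : ℂ}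
    (hβ : α + ∫ t in (0 : ℝ)..T, w t = β) :
    MemH1 T α β (fun t => α + ∫ s in (0 : ℝ)..t, w s) := by
  have hi := intervalIntegrable_of_memLp_volIcc hT hw
  refine ⟨absolutelyContinuousOnInterval_primitive hT hi α, ?_, by simp, hβ⟩
  refine hw.ae_eq ?_
  rw [Filter.EventuallyEq, ae_restrict_iff' measurableSet_Icc]
  filter_upwards [ae_hasDerivAt_primitive hi α] with t ht htT
  exact (ht (by rwa [uIcc_of_le hT])).deriv.symm

theorem MemH1.eq_add_integral {T : ℝ} (hT : 0 ≤ T) {α β : ℂ} {v : ℝ → ℂ} (hv : MemH1 T α β v) :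
    ∀ t ∈ Icc 0 T, v t = α + ∫ s in (0 : ℝ)..t, deriv v s := by
  have := hv.absCont.eq_add_integral_deriv hT (intervalIntegrable_of_memLp_volIcc hT hv.deriv_memLp)
  rwa [hv.left_eq] at this

/-- Integration by parts; the condition `hα` removes the boundary term at `T`. Moments of `v`
thereby become moments of `v'`. -/
theorem mul_expTransform_primitive {T : ℝ} (hT : 0 ≤ T) {w : ℝ → ℂ}
    (hw : IntervalIntegrable w volume 0 T) {α : ℂ} (hα : α + ∫ t in (0 : ℝ)..T, w t = 0) (z : ℂ) :
    z * expTransform T (fun t => α + ∫ s in (0 : ℝ)..t, w s) z = -(α + expTransform T w z) := by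
  have ibp := integral_mul_add_integral_deriv_mul_primitive hT hw
    (e := fun t : ℝ => Complex.exp (z * t)) (e' := fun t : ℝ => z * Complex.exp (z * t))
    (fun x => by
      have : HasDerivAt (fun x : ℝ => (z * (x : ℂ))) (z * 1) x :=
        (HasDerivAt.ofReal_comp (hasDerivAt_id x)).const_mul _
      simpa [mul_comm] using this.cexp) (by fun_prop) α
  rw [hα] at ibp
  simp only [Complex.ofReal_zero, mul_zero, Complex.exp_zero, one_mul, zero_sub, mul_assoc,
    intervalIntegral.integral_const_mul] at ibp
  rw [expTransform, expTransform]
  linear_combination ibp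

/-- The substitute for the preceding identity at `z = 0`, where dividing by `z` is impossible:
integration by parts against `t`. This is where the first moment enters. -/
theorem integral_primitive_eq_neg_moment {T : ℝ} (hT : 0 ≤ T) {w : ℝ → ℂ}
    (hw : IntervalIntegrable w volume 0 T) {α : ℂ} (hα : α + ∫ t in (0 : ℝ)..T, w t = 0) :
    expTransform T (fun t => α + ∫ s in (0 : ℝ)..t, w s) 0 =
      -∫ t in (0 : ℝ)..T, (t : ℂ) * w t := by
  have ibp := integral_mul_add_integral_deriv_mul_primitive hT hw
    (e := fun t : ℝ => (t : ℂ)) (e' := fun _ => 1)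
    (fun x => HasDerivAt.ofReal_comp (hasDerivAt_id x)) continuous_const α
  rw [hα] at ibp
  simp only [Complex.ofReal_zero, mul_zero, zero_mul, sub_zero, one_mul] at ibp
  rw [expTransform_zero]
  linear_combination ibp

theorem sum_option_le {J : Type*} {f : Option J → ℝ} {B : ℝ} (hf : ∀ i, 0 ≤ f i)
    (h : ∀ s : Finset J, ∑ j ∈ s, f (some j) ≤ B) (s : Finset (Option J)) :
    ∑ i ∈ s, f i ≤ f none + B := by
  classical
  calc ∑ i ∈ s, f i ≤ ∑ i ∈ Finset.insertNone (Finset.eraseNone s), f i := by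
        refine Finset.sum_le_sum_of_subset_of_nonneg ?_ fun i _ _ => hf i
        rw [Finset.insertNone_eraseNone]
        exact Finset.subset_insert _ _
    _ = f none + ∑ j ∈ Finset.eraseNone s, f (some j) := Finset.sum_insertNone _ _
    _ ≤ _ := by gcongr; exact h _

/-- Only finitely many `lam j` lie in the unit disc. A zero value is harmless, as its inverse is `0`
by convention. -/
theorem exists_norm_inv_le {J : Type*} {lam : J → ℂ} (hfin : {j | ‖lam j‖ ≤ 1}.Finite) :
    ∃ C : ℝ, 1 ≤ C ∧ ∀ j, ‖lam j‖⁻¹ ≤ C := by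
  have h0 : ∀ j, 0 ≤ ‖lam j‖⁻¹ := fun j => by positivity
  refine ⟨1 + ∑ j ∈ hfin.toFinset, ‖lam j‖⁻¹,
    le_add_of_nonneg_right (Finset.sum_nonneg fun j _ => h0 j), fun j => ?_⟩
  by_cases hj : ‖lam j‖ ≤ 1
  · have := Finset.single_le_sum (f := fun j => ‖lam j‖⁻¹) (fun j _ => h0 j)
      (show j ∈ hfin.toFinset by simpa using hj)
    linarith
  · have := inv_le_one_of_one_le₀ (not_le.1 hj).le
    have := Finset.sum_nonneg (s := hfin.toFinset) fun j _ => h0 j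
    linarith

/-- The moment problem behind the null-controllability of the first equation. -/
theorem exists_memLp_moments {T : ℝ} (hT : 0 ≤ T) {J : Type*} {lam β ξ : J → ℂ}
    (hinj : Function.Injective lam) (hfin : ∀ R : ℝ, {j : J | ‖lam j‖ ≤ R}.Finite)
    (hzero : ∀ j, lam j = 0 → β j ≠ 0) (hmin : StronglyMinimal (augmentedExponentials T lam β))
    {P Q : ℝ} (hβ : ∀ s : Finset J, ∑ j ∈ s, ‖β j‖ ^ 2 ≤ P)
    (hξ : ∀ s : Finset J, ∑ j ∈ s, ‖ξ j‖ ^ 2 ≤ Q) (α : ℂ) :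
    ∃ w : ℝ → ℂ, MemLp w 2 (volIcc T) ∧ α + expTransform T w 0 = 0 ∧
      (∀ j, lam j ≠ 0 → ξ j + β j / lam j * (α + expTransform T w (-lam j)) = 0) ∧
      ∀ j, lam j = 0 → β j * ∫ t in (0 : ℝ)..T, (t : ℂ) * w t = ξ j := by
  classical
  obtain ⟨C, hC1, hC⟩ := exists_norm_inv_le (hfin 1)
  obtain ⟨γ, hγ, hx⟩ := hmin
  have hP : 0 ≤ P := by simpa using hβ ∅
  have hQ : 0 ≤ Q := by simpa using hξ ∅
  set c : Option {j : J // lam j ≠ 0} → ℂ := fun i => i.elim 1 fun j => β j / lam j with hc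
  set μ : Option {j : J // lam j ≠ 0} → ℂ := fun i => i.elim 0 fun j => -lam j with hμ
  have haug : augmentedExponentials T lam β = fun i => expL2 T (c i) (-μ i) := by
    funext i
    cases i <;> simp [augmentedExponentials, hc, hμ]
  rw [haug] at hx
  have hsub : ∀ (f : J → ℝ) (B : ℝ), (∀ s : Finset J, ∑ j ∈ s, f j ≤ B) →
      ∀ s : Finset {j : J // lam j ≠ 0}, ∑ j ∈ s, f j ≤ B := fun f B h s => by
    have := h (s.map (Function.Embedding.subtype _))
    simpa using this
  -- These data encode `ŵ(0) = -α` and the required value of `(β j / λ j) ŵ(-λ j)`, solved from the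
  -- modal equations.
  set d : Option {j : J // lam j ≠ 0} → ℂ := fun i =>
    i.elim (-α) fun j => -ξ j - α * (β j / lam j) with hd
  have hdiv : ∀ j, ‖β j / lam j‖ ≤ C * ‖β j‖ := fun j => by
    rw [norm_div, div_eq_mul_inv, mul_comm]
    gcongr
    exact hC j
  have hdB : ∀ s, ∑ i ∈ s, ‖d i‖ ^ 2 ≤
      √(‖α‖ ^ 2 + (2 * Q + 2 * (‖α‖ * C) ^ 2 * P)) ^ 2 := by
    intro s
    rw [Real.sq_sqrt (by positivity)]
    have h1 := sum_option_le (f := fun i => ‖d i‖ ^ 2) (fun i => by positivity)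
      (hsub (fun j => ‖-ξ j - α * (β j / lam j)‖ ^ 2) (2 * Q + 2 * (‖α‖ * C) ^ 2 * P) fun s => by
        calc ∑ j ∈ s, ‖-ξ j - α * (β j / lam j)‖ ^ 2
            ≤ ∑ j ∈ s, (2 * ‖ξ j‖ ^ 2 + 2 * (‖α‖ * C) ^ 2 * ‖β j‖ ^ 2) := by
              refine Finset.sum_le_sum fun j _ => ?_
              have h2 : ‖-ξ j - α * (β j / lam j)‖ ≤ ‖ξ j‖ + ‖α‖ * C * ‖β j‖ := by
                refine (norm_sub_le _ _).trans ?_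
                rw [norm_neg, norm_mul, mul_assoc]
                gcongr
                exact hdiv j
              calc _ ≤ (‖ξ j‖ + ‖α‖ * C * ‖β j‖) ^ 2 := by gcongr
                _ ≤ _ := by nlinarith [sq_nonneg (‖ξ j‖ - ‖α‖ * C * ‖β j‖)]
          _ = 2 * ∑ j ∈ s, ‖ξ j‖ ^ 2 + 2 * (‖α‖ * C) ^ 2 * ∑ j ∈ s, ‖β j‖ ^ 2 := by
              rw [Finset.sum_add_distrib, Finset.mul_sum, Finset.mul_sum]
          _ ≤ _ := by gcongr; exacts [hξ s, hβ s]) s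
    simpa [hd] using h1
  obtain ⟨w₁, hw₁, hw₁m, -⟩ := exists_memLp_expTransform_eq hT hγ hx (Real.sqrt_nonneg _) hdB
  simp only [neg_neg] at hw₁m
  obtain ⟨w, hw, hwm, hw0⟩ : ∃ w : ℝ → ℂ, MemLp w 2 (volIcc T) ∧
      (∀ i, c i * expTransform T w (μ i) = d i) ∧
      ∀ j, lam j = 0 → β j * ∫ t in (0 : ℝ)..T, (t : ℂ) * w t = ξ j := by
    by_cases hex : ∃ j, lam j = 0
    · obtain ⟨j₀, hj₀⟩ := hex
      have hμinj : Function.Injective μ := by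
        intro i i' h
        cases i with
        | none =>
          cases i' with
          | none => rfl
          | some j => exact absurd (neg_eq_zero.1 (show -lam j = 0 from h.symm)) j.2
        | some j =>
          cases i' with
          | none => exact absurd (neg_eq_zero.1 (show -lam j = 0 from h)) j.2
          | some j' => rw [Subtype.ext (hinj (neg_injective (show -lam j = -lam j' from h)))]
      have hμfin : ∀ R : ℝ, {i | ‖μ i‖ ≤ R}.Finite := by
        intro R
        have h1 : {j : {j : J // lam j ≠ 0} | ‖lam j‖ ≤ R}.Finite :=
          (hfin R).preimage Subtype.val_injective.injOn
        refine ((h1.image some).insert none).subset ?_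
        intro i hi
        cases i with
        | none => exact mem_insert _ _
        | some j => exact mem_insert_of_mem _ ⟨j, by simpa [hμ] using hi, rfl⟩
      have hcB : ∀ s, ∑ i ∈ s, (‖c i‖ * (1 + ‖μ i‖)) ^ 2 ≤ √(1 + (1 + C) ^ 2 * P) ^ 2 := by
        intro s
        rw [Real.sq_sqrt (by positivity)]
        have h1 := sum_option_le (f := fun i => (‖c i‖ * (1 + ‖μ i‖)) ^ 2)
          (B := (1 + C) ^ 2 * P) (fun i => by positivity)
          (fun s => by
            calc _ ≤ ∑ j ∈ s, (1 + C) ^ 2 * ‖β j‖ ^ 2 := by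
                  refine Finset.sum_le_sum fun j _ => ?_
                  have h2 : ‖lam j‖⁻¹ * ‖lam j‖ = 1 := inv_mul_cancel₀ (norm_ne_zero_iff.2 j.2)
                  have h3 : ‖c (some j)‖ * (1 + ‖μ (some j)‖) ≤ (1 + C) * ‖β j‖ := by
                    simp only [hc, hμ, Option.elim_some, norm_neg, norm_div]
                    rw [div_eq_mul_inv]
                    calc ‖β j‖ * ‖lam j‖⁻¹ * (1 + ‖lam j‖) =
                          ‖β j‖ * (‖lam j‖⁻¹ + ‖lam j‖⁻¹ * ‖lam j‖) := by ring
                      _ ≤ ‖β j‖ * (C + 1) := by rw [h2]; gcongr; exact hC j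
                      _ = _ := by ring
                  rw [← mul_pow]
                  gcongr
              _ = (1 + C) ^ 2 * ∑ j ∈ s, ‖β j‖ ^ 2 := by rw [Finset.mul_sum]
              _ ≤ _ := by gcongr; exact hsub (fun j => ‖β j‖ ^ 2) P hβ s) s
        simpa [hc, hμ] using h1
      obtain ⟨w₂, hw₂, hw₂m, hw₂0⟩ := exists_annihilator_moment_ne_zero hT hγ (Real.sqrt_nonneg _)
        hx hμinj hμfin (i₀ := none) rfl hcB
      have hi₁ := intervalIntegrable_of_memLp_volIcc hT hw₁
      have hi₂ := intervalIntegrable_of_memLp_volIcc hT hw₂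
      set I₁ := ∫ t in (0 : ℝ)..T, (t : ℂ) * w₁ t with hI₁
      set I₂ := ∫ t in (0 : ℝ)..T, (t : ℂ) * w₂ t with hI₂
      -- Adding a multiple of the annihilator `w₂` leaves the other moments unchanged and adjusts
      -- the first moment to `ξ j₀ / β j₀`.
      set κ := (ξ j₀ / β j₀ - I₁) / I₂ with hκ
      refine ⟨fun t => w₁ t + κ * w₂ t, hw₁.add (hw₂.const_mul κ), fun i => ?_, fun j hj => ?_⟩
      · rw [expTransform_add hi₁ (hi₂.const_mul κ), expTransform_const_mul, hw₂m, mul_zero,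
          add_zero, hw₁m]
      · obtain rfl : j = j₀ := hinj (hj.trans hj₀.symm)
        have h1 : ∫ t in (0 : ℝ)..T, (t : ℂ) * (w₁ t + κ * w₂ t) = I₁ + κ * I₂ := by
          have hc : ContinuousOn (fun t : ℝ => (t : ℂ)) (uIcc 0 T) :=
            Complex.continuous_ofReal.continuousOn
          rw [hI₁, hI₂, ← intervalIntegral.integral_const_mul, ← intervalIntegral.integral_add
            (hi₁.continuousOn_mul hc) ((hi₂.continuousOn_mul hc).const_mul κ)]
          refine intervalIntegral.integral_congr fun t _ => ?_
          ring
        rw [h1, hκ, div_mul_cancel₀ _ hw₂0]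
        have := hzero j hj
        field_simp
        ring
    · exact ⟨w₁, hw₁, hw₁m, fun j hj => absurd ⟨j, hj⟩ hex⟩
  refine ⟨w, hw, ?_, fun j hj => ?_, hw0⟩
  · have := hwm none
    simp only [hc, hμ, hd, Option.elim_none, one_mul] at this
    rw [this]; ring
  · have := hwm (some ⟨j, hj⟩)
    simp only [hc, hμ, hd, Option.elim_some] at this
    linear_combination this

/-- Null-controllability by absolutely continuous controls with prescribed initial value and final
value `0`. -/
theorem exists_memH1_mildSolution_eq_zero {X J : Type*} [NormedAddCommGroup X]
    [InnerProductSpace ℂ X] [CompleteSpace X] {S : C0Semigroup X} {A : X →ₗ.[ℂ] X}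
    (hS : S.HasGenerator A) {lam : J → ℂ} {φ ψ : J → X} {b : X} {T : ℝ} (hT : 0 ≤ T)
    (hinj : Function.Injective lam) (hfin : ∀ R : ℝ, {j : J | ‖lam j‖ ≤ R}.Finite)
    (hA : ∀ j, (φ j, lam j • φ j) ∈ A.graph) (hφ : IsRieszBasis φ)
    (h1 : ∀ j, inner ℂ (ψ j) (φ j) = 1) (h0 : ∀ i j, i ≠ j → inner ℂ (ψ i) (φ j) = 0)
    (hzero : ∀ j, lam j = 0 → inner ℂ (ψ j) b ≠ 0)
    (hmin : StronglyMinimal (augmentedExponentials T lam fun j => inner ℂ (ψ j) b)) (x : X)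
    (α : ℂ) : ∃ v : ℝ → ℂ, MemH1 T α 0 v ∧ mildSolution S b x v T = 0 := by
  obtain ⟨m, hm, hb⟩ := hφ.exists_bessel h1 h0
  have hbd : ∀ (y : X) (s : Finset J), ∑ j ∈ s, ‖inner ℂ (ψ j) y‖ ^ 2 ≤ ‖y‖ ^ 2 / m := fun y s => by
    rw [le_div_iff₀ hm, mul_comm]; exact hb s y
  obtain ⟨w, hw, hwα, hwj, hw0⟩ := exists_memLp_moments hT hinj hfin hzero hmin (hbd b) (hbd x) α
  have hi := intervalIntegrable_of_memLp_volIcc hT hw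
  rw [expTransform_zero] at hwα
  have hH1 := memH1_primitive hT hw hwα
  refine ⟨_, hH1, hφ.eq_zero_of_forall_inner h1 h0 fun j => ?_⟩
  have hvi : IntervalIntegrable (fun t => α + ∫ s in (0 : ℝ)..t, w s) volume 0 T := by
    refine ContinuousOn.intervalIntegrable ?_
    rw [uIcc_of_le hT]
    exact continuousOn_primitive_Icc hT hi α
  rw [inner_mildSolution hS hA hφ h0 j hT b x hvi, mul_eq_zero]
  right
  by_cases hj : lam j = 0
  · rw [hj, neg_zero, integral_primitive_eq_neg_moment hT hi hwα, ← hw0 j hj]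
    ring
  · have h2 := mul_expTransform_primitive hT hi hwα (-lam j)
    have h3 := hwj j hj
    have h4 : expTransform T (fun t => α + ∫ s in (0 : ℝ)..t, w s) (-lam j) =
        (α + expTransform T w (-lam j)) / lam j := by
      rw [eq_div_iff hj]; linear_combination -h2
    rw [h4, ← h3]
    ring

/-! ### Volterra equations of the second kind. -/

theorem continuous_volterra {k f : ℝ → ℂ} (hk : Continuous k) (hf : Continuous f) :
    Continuous fun t : ℝ => ∫ τ in (0 : ℝ)..t, k (t - τ) * f τ :=
  intervalIntegral.continuous_parametric_intervalIntegral_of_continuous (by fun_prop)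
    continuous_id

/-- A Volterra equation of the second kind with small kernel has a continuous solution. -/
theorem exists_volterra_of_small {k q : ℝ → ℂ} {κ : ℂ} {T : ℝ} (hT : 0 ≤ T) (hκ : κ ≠ 0)
    (hk : Continuous k) (hsmall : ∀ t ∈ Icc 0 T, ∫ s in (0 : ℝ)..t, ‖k s‖ ≤ ‖κ‖ / 2)
    (hq : ContinuousOn q (Icc 0 T)) :
    ∃ h : ℝ → ℂ, Continuous h ∧
      ∀ t ∈ Icc 0 T, κ * h t + ∫ τ in (0 : ℝ)..t, k (t - τ) * h τ = q t := by
  have hext : ∀ y : C(Icc 0 T, ℂ), Continuous (IccExtend hT y) := fun y => y.continuous.Icc_extend'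
  let Φ : C(Icc 0 T, ℂ) → C(Icc 0 T, ℂ) := fun y =>
    ⟨fun t => κ⁻¹ * (q t - ∫ τ in (0 : ℝ)..t, k (t - τ) * IccExtend hT y τ), by
      exact continuous_const.mul ((continuousOn_iff_continuous_domRestrict.1 hq).sub
        ((continuous_volterra hk (hext y)).comp continuous_subtype_val))⟩
  have hΦ : ContractingWith (1 / 2) Φ := by
    refine ⟨by rw [← NNReal.coe_lt_coe]; norm_num, LipschitzWith.of_dist_le_mul fun y y' => ?_⟩
    rw [ContinuousMap.dist_le (by positivity)]
    intro t
    have hκ' : 0 < ‖κ‖ := norm_pos_iff.2 hκ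
    have hint : ∀ y : C(Icc 0 T, ℂ),
        IntervalIntegrable (fun τ => k (t - τ) * IccExtend hT y τ) volume 0 t := fun y =>
      ((hk.comp (by fun_prop)).mul (hext y)).intervalIntegrable _ _
    have h1 : Φ y t - Φ y' t =
        -(κ⁻¹ * ∫ τ in (0 : ℝ)..t, k (t - τ) * (IccExtend hT y τ - IccExtend hT y' τ)) := by
      simp only [Φ, ContinuousMap.coe_mk, mul_sub]
      rw [intervalIntegral.integral_sub (hint y) (hint y')]
      ring
    have h2 : ‖∫ τ in (0 : ℝ)..t, k (t - τ) * (IccExtend hT y τ - IccExtend hT y' τ)‖ ≤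
        ∫ τ in (0 : ℝ)..t, ‖k (t - τ)‖ * dist y y' := by
      refine intervalIntegral.norm_integral_le_of_norm_le t.2.1 (Eventually.of_forall fun τ _ => ?_)
        (Continuous.intervalIntegrable (by fun_prop) _ _)
      rw [norm_mul, ← dist_eq_norm]
      gcongr
      exact ContinuousMap.dist_apply_le_dist _
    have h3 : ∫ τ in (0 : ℝ)..t, ‖k (t - τ)‖ * dist y y' ≤ ‖κ‖ / 2 * dist y y' := by
      rw [intervalIntegral.integral_mul_const,
        intervalIntegral.integral_comp_sub_left (fun s => ‖k s‖)]
      simp only [sub_self, sub_zero]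
      gcongr
      exact hsmall t t.2
    rw [dist_eq_norm, h1, norm_neg, norm_mul, norm_inv, inv_mul_le_iff₀ hκ']
    refine (h2.trans h3).trans_eq ?_
    push_cast
    ring
  refine ⟨IccExtend hT hΦ.fixedPoint, hext _, fun t ht => ?_⟩
  have h1 := congrArg (fun y : C(Icc 0 T, ℂ) => y ⟨t, ht⟩) hΦ.fixedPoint_isFixedPt
  simp only [Φ, ContinuousMap.coe_mk] at h1
  rw [IccExtend_of_mem hT _ ht]
  rw [inv_mul_eq_iff_eq_mul₀ hκ] at h1
  linear_combination -h1

theorem integral_exp_neg_mul_le {a : ℝ} (ha : 0 < a) (t : ℝ) :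
    ∫ s in (0 : ℝ)..t, Real.exp (-a * s) ≤ 1 / a := by
  have h := intervalIntegral.integral_eq_sub_of_hasDerivAt (a := 0) (b := t)
    (f := fun s => -Real.exp (-a * s) / a) (f' := fun s => Real.exp (-a * s))
    (fun s _ => by
      have h1 : HasDerivAt (fun s : ℝ => -a * s) (-a * 1) s := (hasDerivAt_id s).const_mul _
      have h2 := (h1.exp.neg).div_const a
      have h3 : -(Real.exp (-a * s) * (-a * 1)) / a = Real.exp (-a * s) := by field_simp
      exact h3 ▸ h2)
    (Continuous.intervalIntegrable (by fun_prop) _ _)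
  rw [h, ← sub_div]
  gcongr
  simp only [mul_zero, Real.exp_zero]
  linarith [Real.exp_pos (-a * t)]

/-- For a large exponential weight the kernel of a Volterra equation becomes small. -/
theorem exists_weight_integral_norm_le {k : ℝ → ℂ} (hk : Continuous k) {κ : ℂ} (hκ : κ ≠ 0)
    (T : ℝ) : ∃ a : ℝ, ∀ t ∈ Icc 0 T,
      ∫ s in (0 : ℝ)..t, ‖Complex.exp ((-a * s : ℝ)) * k s‖ ≤ ‖κ‖ / 2 := by
  obtain ⟨M, hM⟩ := isCompact_Icc.exists_bound_of_continuousOn (s := Icc 0 T) hk.continuousOn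
  have hκ' : 0 < ‖κ‖ := norm_pos_iff.2 hκ
  -- The weighted kernel has integral at most `|M|/a`, and this `a` makes that at most `‖κ‖/2`.
  set a : ℝ := 2 * (|M| + 1) / ‖κ‖ with ha
  have ha0 : 0 < a := by positivity
  refine ⟨a, fun t ht => ?_⟩
  calc _ ≤ ∫ s in (0 : ℝ)..t, |M| * Real.exp (-a * s) := by
        refine intervalIntegral.integral_mono_on ht.1
          (Continuous.intervalIntegrable (by fun_prop) _ _)
          (Continuous.intervalIntegrable (by fun_prop) _ _) fun s hs => ?_
        rw [norm_mul, ← Complex.ofReal_exp, Complex.norm_real, Real.norm_of_nonneg (Real.exp_pos _).le,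
          mul_comm]
        gcongr
        exact (hM s ⟨hs.1, hs.2.trans ht.2⟩).trans (le_abs_self M)
    _ ≤ |M| * (1 / a) := by
        rw [intervalIntegral.integral_const_mul]
        gcongr
        exact integral_exp_neg_mul_le ha0 t
    _ ≤ ‖κ‖ / 2 := by
        rw [mul_one_div, div_le_iff₀ ha0, ha]
        have : ‖κ‖ / 2 * (2 * (|M| + 1) / ‖κ‖) = |M| + 1 := by field_simp
        linarith

/-- As `e^{-at} = e^{-a(t-τ)} e^{-aτ}`, weighting kernel and unknown alike preserves the form of the
equation; this reduces everything to small kernels. -/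
theorem exp_weight_volterra (a t : ℝ) (k f : ℝ → ℂ) :
    ∫ τ in (0 : ℝ)..t, Complex.exp ((-a * (t - τ) : ℝ)) * k (t - τ) *
      (Complex.exp ((-a * τ : ℝ)) * f τ) =
    Complex.exp ((-a * t : ℝ)) * ∫ τ in (0 : ℝ)..t, k (t - τ) * f τ := by
  rw [← intervalIntegral.integral_const_mul]
  refine intervalIntegral.integral_congr fun τ _ => ?_
  have : Complex.exp ((-a * t : ℝ)) =
      Complex.exp ((-a * (t - τ) : ℝ)) * Complex.exp ((-a * τ : ℝ)) := by
    rw [← Complex.exp_add]; push_cast; ring_nf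
  simp only [this]
  ring

/-- Volterra equations of the second kind with continuous data have continuous solutions. -/
theorem exists_volterra {k q : ℝ → ℂ} {κ : ℂ} {T : ℝ} (hT : 0 ≤ T) (hκ : κ ≠ 0)
    (hk : Continuous k) (hq : ContinuousOn q (Icc 0 T)) :
    ∃ h : ℝ → ℂ, Continuous h ∧
      ∀ t ∈ Icc 0 T, κ * h t + ∫ τ in (0 : ℝ)..t, k (t - τ) * h τ = q t := by
  obtain ⟨a, ha⟩ := exists_weight_integral_norm_le hk hκ T
  obtain ⟨y, hy, hyq⟩ := exists_volterra_of_small (k := fun s => Complex.exp ((-a * s : ℝ)) * k s)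
    (q := fun t => Complex.exp ((-a * t : ℝ)) * q t) hT hκ (by fun_prop) ha
    ((by fun_prop : Continuous fun t : ℝ => Complex.exp ((-a * t : ℝ))).continuousOn.mul hq)
  have hye : ∀ τ : ℝ, y τ = Complex.exp ((-a * τ : ℝ)) * (Complex.exp ((a * τ : ℝ)) * y τ) :=
    fun τ => by
      rw [← mul_assoc, ← Complex.exp_add, ← Complex.ofReal_add]; simp
  refine ⟨fun t => Complex.exp ((a * t : ℝ)) * y t, by fun_prop, fun t ht => ?_⟩
  have h1 := hyq t ht
  have h2 := exp_weight_volterra a t k fun τ => Complex.exp ((a * τ : ℝ)) * y τ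
  simp only [← hye] at h2
  rw [h2] at h1
  refine mul_left_cancel₀ (Complex.exp_ne_zero ((-a * t : ℝ))) ?_
  rw [← h1, mul_add]
  linear_combination (-κ) * hye t

/-- Uniqueness for homogeneous Volterra equations of the second kind. -/
theorem eqOn_zero_of_volterra {k f : ℝ → ℂ} {κ : ℂ} {T : ℝ} (hκ : κ ≠ 0)
    (hk : Continuous k) (hf : ContinuousOn f (Icc 0 T))
    (h : ∀ t ∈ Icc 0 T, κ * f t + ∫ τ in (0 : ℝ)..t, k (t - τ) * f τ = 0) :
    ∀ t ∈ Icc 0 T, f t = 0 := by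
  intro t ht
  obtain ⟨a, ha⟩ := exists_weight_integral_norm_le hk hκ T
  have hκ' : 0 < ‖κ‖ := norm_pos_iff.2 hκ
  have hyc : ContinuousOn (fun t : ℝ => ‖Complex.exp ((-a * t : ℝ)) * f t‖) (Icc 0 T) :=
    ((by fun_prop : Continuous fun t : ℝ => Complex.exp ((-a * t : ℝ))).continuousOn.mul hf).norm
  obtain ⟨r, hr, hmax⟩ := isCompact_Icc.exists_isMaxOn ⟨t, ht⟩ hyc
  set m : ℝ := ‖Complex.exp ((-a * r : ℝ)) * f r‖ with hm
  have hm0 : 0 ≤ m := norm_nonneg _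
  have h1 : κ * (Complex.exp ((-a * r : ℝ)) * f r) =
      -∫ τ in (0 : ℝ)..r, Complex.exp ((-a * (r - τ) : ℝ)) * k (r - τ) *
        (Complex.exp ((-a * τ : ℝ)) * f τ) := by
    rw [exp_weight_volterra]
    linear_combination (Complex.exp ((-a * r : ℝ))) * h r hr
  -- At a maximum point `r` of the weighted modulus, the equation bounds `‖κ‖ m` by half of itself,
  -- so `m = 0`.
  have h2 : ‖κ‖ * m ≤ ‖κ‖ / 2 * m := by
    rw [hm, ← norm_mul, h1, norm_neg]
    calc _ ≤ ∫ τ in (0 : ℝ)..r, ‖Complex.exp ((-a * (r - τ) : ℝ)) * k (r - τ)‖ * m := by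
          refine intervalIntegral.norm_integral_le_of_norm_le hr.1
            (Eventually.of_forall fun τ hτ => ?_)
            (Continuous.intervalIntegrable (by fun_prop) _ _)
          rw [norm_mul]
          gcongr
          exact hmax ⟨hτ.1.le, hτ.2.trans hr.2⟩
      _ ≤ ‖κ‖ / 2 * m := by
          rw [intervalIntegral.integral_mul_const, intervalIntegral.integral_comp_sub_left
            (fun s => ‖Complex.exp ((-a * s : ℝ)) * k s‖)]
          simp only [sub_self, sub_zero]
          gcongr
          exact ha r hr
  have h3 : m = 0 := by nlinarith
  have h4 : ‖Complex.exp ((-a * t : ℝ)) * f t‖ ≤ m := hmax ht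
  rw [h3] at h4
  exact (mul_eq_zero.1 (norm_le_zero_iff.1 h4)).resolve_left (Complex.exp_ne_zero _)

/-- The convolution of a continuous kernel with an integrable function is continuous. -/
theorem continuousOn_volterra_of_intervalIntegrable {k f : ℝ → ℂ} {T : ℝ} (hT : 0 ≤ T)
    (hk : Continuous k) (hf : IntervalIntegrable f volume 0 T) :
    ContinuousOn (fun t => ∫ τ in (0 : ℝ)..t, k (t - τ) * f τ) (Icc 0 T) := by
  -- Subtracting `k 0` and clamping makes `k₀` continuous, bounded and zero for negative arguments.
  -- The integral can then run over all of `[0, T]`, and dominated convergence applies; the part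
  -- with `k 0` is a primitive.
  set k₀ : ℝ → ℂ := fun s => k (max 0 (min s T)) - k 0 with hk₀
  have hk₀c : Continuous k₀ := by fun_prop
  obtain ⟨M, hM⟩ := isCompact_Icc.exists_bound_of_continuousOn (s := Icc 0 T) hk.continuousOn
  have hk₀b : ∀ s, ‖k₀ s‖ ≤ M + ‖k 0‖ := fun s =>
    (norm_sub_le _ _).trans (by
      gcongr
      exact hM _ ⟨le_max_left _ _, max_le hT (min_le_right _ _)⟩)
  have hcont : Continuous fun t => ∫ τ in (0 : ℝ)..T, k₀ (t - τ) * f τ :=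
    intervalIntegral.continuous_of_dominated_interval
      (bound := fun τ => (M + ‖k 0‖) * ‖f τ‖)
      (fun t => (hf.continuousOn_mul (by fun_prop)).aestronglyMeasurable_restrict_uIoc)
      (fun t => Eventually.of_forall fun τ _ => by
        rw [norm_mul]; gcongr; exact hk₀b _)
      (hf.norm.const_mul _)
      (Eventually.of_forall fun τ _ => by fun_prop)
  refine ((continuousOn_primitive_Icc hT hf 0).const_smul (k 0) |>.add hcont.continuousOn).congr
    fun t ht => ?_
  have hft := hf.zero_left_of_mem ht
  have hftT : IntervalIntegrable f volume t T := hft.symm.trans hf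
  have hi : ∀ {a b}, IntervalIntegrable f volume a b →
      IntervalIntegrable (fun τ => k₀ (t - τ) * f τ) volume a b := fun h =>
    h.continuousOn_mul (by fun_prop)
  have h1 : ∫ τ in t..T, k₀ (t - τ) * f τ = 0 := by
    rw [← intervalIntegral.integral_zero (a := t) (b := T) (μ := volume)]
    refine intervalIntegral.integral_congr fun τ hτ => ?_
    rw [uIcc_of_le ht.2] at hτ
    have : max 0 (min (t - τ) T) = 0 := max_eq_left ((min_le_left _ _).trans (by linarith [hτ.1]))
    simp [hk₀, this]
  simp only [zero_add, Pi.add_apply, Pi.smul_apply, smul_eq_mul]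
  rw [← intervalIntegral.integral_add_adjacent_intervals (hi hft) (hi hftT), h1, add_zero,
    ← intervalIntegral.integral_const_mul, ← intervalIntegral.integral_add (hft.const_mul _) (hi hft)]
  refine intervalIntegral.integral_congr fun τ hτ => ?_
  rw [uIcc_of_le ht.1] at hτ
  have : max 0 (min (t - τ) T) = t - τ := by
    rw [min_eq_left (by linarith [hτ.1, ht.2]), max_eq_right (by linarith [hτ.2])]
  simp only [hk₀, this]
  ring

theorem hasDerivAt_integral_kernel {k : ℝ → ℂ} (hk : Continuous k) (κ : ℂ) (t x : ℝ) :
    HasDerivAt (fun τ => κ + ∫ s in (0 : ℝ)..t - τ, k s) (-k (t - x)) x := by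
  have h1 : HasDerivAt (fun u => ∫ s in (0 : ℝ)..u, k s) (k (t - x)) (t - x) :=
    intervalIntegral.integral_hasDerivAt_right (hk.intervalIntegrable _ _)
      hk.aestronglyMeasurable.stronglyMeasurableAtFilter hk.continuousAt
  have h2 : HasDerivAt (fun τ : ℝ => t - τ) (-1) x := by
    simpa using (hasDerivAt_id x).const_sub t
  have h3 := (HasDerivAt.scomp x h1 h2).const_add κ
  simpa using h3

/-- Integration by parts in `τ`: the factor `κ + ∫₀^{t-τ} k` has derivative `-k(t - τ)` and equals
`κ` at `τ = t`. -/
theorem integral_kernel_mul_eq {k f : ℝ → ℂ} (hk : Continuous k) (κ : ℂ) {t : ℝ} (ht : 0 ≤ t)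
    (hf : IntervalIntegrable f volume 0 t) :
    ∫ τ in (0 : ℝ)..t, (κ + ∫ s in (0 : ℝ)..t - τ, k s) * f τ =
      κ * (∫ s in (0 : ℝ)..t, f s) +
        ∫ τ in (0 : ℝ)..t, k (t - τ) * ∫ s in (0 : ℝ)..τ, f s := by
  have ibp := integral_mul_add_integral_deriv_mul_primitive ht hf
    (hasDerivAt_integral_kernel hk κ t) (by fun_prop) 0
  simp only [sub_self, intervalIntegral.integral_same, add_zero, zero_add, mul_zero, sub_zero,
    neg_mul, intervalIntegral.integral_neg] at ibp
  linear_combination ibp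

/-- Integrating a convolution amounts to integrating one of its factors. -/
theorem integral_volterra {k f : ℝ → ℂ} (hk : Continuous k) {t : ℝ} (ht : 0 ≤ t)
    (hf : IntervalIntegrable f volume 0 t) :
    ∫ s in (0 : ℝ)..t, ∫ τ in (0 : ℝ)..s, k (s - τ) * f τ =
      ∫ τ in (0 : ℝ)..t, k (t - τ) * ∫ s in (0 : ℝ)..τ, f s := by
  have h0 := integral_kernel_mul_eq hk 0 ht hf
  simp only [zero_add, zero_mul] at h0
  rw [← h0]
  -- The indicator extends the triangle `τ ≤ s` to a square, so Fubini applies; the inner integral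
  -- over `s` is then `∫₀^{t-τ} k`.
  set θ : ℝ → ℂ := (Ici (0 : ℝ)).indicator k with hθ
  have hθm : Measurable θ := hk.measurable.indicator measurableSet_Ici
  obtain ⟨M, hM⟩ := isCompact_Icc.exists_bound_of_continuousOn (s := Icc 0 t) hk.continuousOn
  have hM0 : 0 ≤ M := (norm_nonneg _).trans (hM 0 ⟨le_rfl, ht⟩)
  set ν := volume.restrict (Ioc 0 t) with hν
  have hfν : Integrable f ν := (intervalIntegrable_iff_integrableOn_Ioc_of_le ht).1 hf
  have hint : Integrable (fun p : ℝ × ℝ => θ (p.1 - p.2) * f p.2) (ν.prod ν) := by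
    refine Integrable.mono' (g := fun p => M * ‖f p.2‖) ((hfν.norm.comp_snd ν).const_mul M) ?_ ?_
    · exact (hθm.comp (measurable_fst.sub measurable_snd)).aestronglyMeasurable.mul
        hfν.aestronglyMeasurable.comp_snd
    · rw [hν, Measure.prod_restrict, ae_restrict_iff' (measurableSet_Ioc.prod measurableSet_Ioc)]
      refine Eventually.of_forall fun p hp => ?_
      rw [norm_mul]
      gcongr
      rw [hθ, indicator]
      split_ifs with h
      · exact hM _ ⟨h, by linarith [hp.1.2, hp.2.1]⟩
      · simpa using hM0
  have hswap := integral_integral_swap (f := fun s τ => θ (s - τ) * f τ) hint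
  rw [intervalIntegral.integral_of_le ht, intervalIntegral.integral_of_le ht]
  calc _ = ∫ s in Ioc 0 t, ∫ τ in Ioc 0 t, θ (s - τ) * f τ := by
        refine setIntegral_congr_fun measurableSet_Ioc fun s hs => ?_
        have hsub := setIntegral_eq_of_subset_of_forall_sdiff_eq_zero (μ := volume)
          (f := fun τ => θ (s - τ) * f τ) measurableSet_Ioc (Ioc_subset_Ioc_right hs.2 : Ioc 0 s ⊆ Ioc 0 t)
          (fun τ hτ => by
            have : s < τ := by
              by_contra h
              exact hτ.2 ⟨hτ.1.1, not_lt.1 h⟩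
            rw [hθ, indicator_of_notMem (by simpa using this), zero_mul])
        refine Eq.trans ?_ hsub.symm
        rw [intervalIntegral.integral_of_le hs.1.le]
        refine setIntegral_congr_fun measurableSet_Ioc fun τ hτ => ?_
        simp only [hθ]
        rw [indicator_of_mem (mem_Ici.2 (sub_nonneg.2 hτ.2))]
    _ = ∫ τ in Ioc 0 t, ∫ s in Ioc 0 t, θ (s - τ) * f τ := hswap
    _ = _ := by
        refine setIntegral_congr_fun measurableSet_Ioc fun τ hτ => ?_
        rw [integral_mul_const]
        congr 1
        have hsub := setIntegral_eq_of_subset_of_forall_sdiff_eq_zero (μ := volume)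
          (f := fun s => θ (s - τ)) measurableSet_Ioc
          (fun s hs => ⟨hτ.1.trans_le hs.1, hs.2⟩ : Icc τ t ⊆ Ioc 0 t)
          (fun s hs => by
            have : s < τ := by
              by_contra h
              exact hs.2 ⟨not_lt.1 h, hs.1.2⟩
            rw [hθ, indicator_of_notMem (by simpa using this)])
        rw [hsub]
        have h1 := intervalIntegral.integral_comp_sub_right (a := τ) (b := t) k τ
        rw [sub_self] at h1
        rw [← h1, intervalIntegral.integral_of_le hτ.2, ← integral_Icc_eq_integral_Ioc]
        refine setIntegral_congr_fun measurableSet_Icc fun s hs => ?_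
        simp only [hθ]
        rw [indicator_of_mem (mem_Ici.2 (sub_nonneg.2 hs.1))]

/-- Regularity for Volterra equations of the second kind: if the right-hand side is the primitive
of a square integrable function, then so is a solution. -/
theorem exists_memLp_volterra {k g : ℝ → ℂ} {κ : ℂ} {T : ℝ} (hT : 0 ≤ T) (hκ : κ ≠ 0)
    (hk : Continuous k) (hg : MemLp g 2 (volIcc T)) :
    ∃ u : ℝ → ℂ, MemLp u 2 (volIcc T) ∧ ∀ t ∈ Icc 0 T,
      κ * (∫ s in (0 : ℝ)..t, u s) + ∫ τ in (0 : ℝ)..t, k (t - τ) * ∫ s in (0 : ℝ)..τ, u s =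
        ∫ s in (0 : ℝ)..t, g s := by
  have hgi := intervalIntegrable_of_memLp_volIcc hT hg
  have hg' := hgi.const_mul κ⁻¹
  -- The ansatz `u = κ⁻¹ g - h` in `κ u + k ∗ u = g` leaves for `h` the right-hand side `k ∗ (κ⁻¹
  -- g)`, which is continuous although `g` is only square integrable. Integrating this equation
  -- gives the one for `∫ u`.
  obtain ⟨h, hh, hhq⟩ := exists_volterra hT hκ hk
    (continuousOn_volterra_of_intervalIntegrable hT hk hg')
  have hu : MemLp (fun t => κ⁻¹ * g t - h t) 2 (volIcc T) :=
    (hg.const_mul κ⁻¹).sub hh.continuousOn.memLp_volIcc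
  have hui := intervalIntegrable_of_memLp_volIcc hT hu
  refine ⟨_, hu, fun t ht => ?_⟩
  have huc := continuousOn_volterra_of_intervalIntegrable hT hk hui
  have hsub : ∀ {s}, s ∈ Icc 0 t → s ∈ Icc 0 T := fun hs => ⟨hs.1, hs.2.trans ht.2⟩
  have huit := hui.zero_left_of_mem ht
  have hint : IntervalIntegrable (fun s => ∫ τ in (0 : ℝ)..s, k (s - τ) * (κ⁻¹ * g τ - h τ))
      volume 0 t := by
    refine ContinuousOn.intervalIntegrable (huc.mono fun s hs => ?_)
    rw [uIcc_of_le ht.1] at hs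
    exact hsub hs
  rw [← integral_volterra hk ht.1 huit, ← intervalIntegral.integral_const_mul,
    ← intervalIntegral.integral_add (huit.const_mul κ) hint]
  refine intervalIntegral.integral_congr fun s hs => ?_
  rw [uIcc_of_le ht.1] at hs
  have h1 := hhq s (hsub hs)
  have i1 : IntervalIntegrable (fun τ => k (s - τ) * (κ⁻¹ * g τ)) volume 0 s :=
    (hg'.zero_left_of_mem (hsub hs)).continuousOn_mul (by fun_prop)
  have i2 : IntervalIntegrable (fun τ => k (s - τ) * h τ) volume 0 s :=
    Continuous.intervalIntegrable (by fun_prop) _ _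
  have h2 : ∫ τ in (0 : ℝ)..s, k (s - τ) * (κ⁻¹ * g τ - h τ) =
      (∫ τ in (0 : ℝ)..s, k (s - τ) * (κ⁻¹ * g τ)) - ∫ τ in (0 : ℝ)..s, k (s - τ) * h τ := by
    rw [← intervalIntegral.integral_sub i1 i2]
    simp only [mul_sub]
  rw [h2, ← h1]
  field_simp
  ring

/-! ### Recovering the control from a prescribed output. -/

section Output

variable {X : Type*} [NormedAddCommGroup X] [InnerProductSpace ℂ X] [CompleteSpace X]
  {S : C0Semigroup X} {A : X →ₗ.[ℂ] X}

omit [CompleteSpace X] in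
theorem C0Semigroup.continuous_inner_orbit (S : C0Semigroup X) (a b : X) :
    Continuous fun s => inner ℂ a (S.orbit b s) :=
  continuous_const.inner (S.continuous_orbit b)

/-- The output of the second equation in terms of the primitive of the control. -/
theorem outputSignal_eq (hS : S.HasGenerator A) {c : X} (hc : c ∈ A.adjoint.domain) (b x : X)
    {t : ℝ} (ht : 0 ≤ t) {u : ℝ → ℂ} (hu : IntervalIntegrable u volume 0 t) :
    outputSignal S b c x u t = inner ℂ c (S.op t x) + (inner ℂ c b * (∫ s in (0 : ℝ)..t, u s) +
      ∫ τ in (0 : ℝ)..t, inner ℂ (A.adjoint ⟨c, hc⟩) (S.orbit b (t - τ)) *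
        ∫ s in (0 : ℝ)..τ, u s) := by
  have hk := S.continuous_inner_orbit (A.adjoint ⟨c, hc⟩) b
  rw [outputSignal, mildSolution, inner_add_right,
    ← integral_kernel_mul_eq (k := fun s => inner ℂ (A.adjoint ⟨c, hc⟩) (S.orbit b s)) hk
      (inner ℂ c b) ht hu]
  have h2 := ContinuousLinearMap.intervalIntegral_comp_comm (innerSL ℂ c)
    (S.intervalIntegrable_smul_op b ht hu)
  simp only [innerSL_apply_apply] at h2
  rw [← h2]
  congr 1
  refine intervalIntegral.integral_congr fun τ hτ => ?_
  rw [uIcc_of_le ht] at hτ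
  have h3 := C0Semigroup.inner_op_eq_add_integral hS hc b (sub_nonneg.2 hτ.2)
  simp only [inner_smul_right]
  rw [h3, mul_comm]

/-- Only times `t - τ ≥ 0` occur, so the kernel may be replaced by one continuous on all of `ℝ`, as
the Volterra lemmas require. -/
theorem solvesVolterra_adjoint_iff (S : C0Semigroup X) (a b : X) {T : ℝ} {κ : ℂ}
    {w U : ℝ → ℂ} :
    SolvesVolterra T κ (fun s => inner ℂ ((S.op s).adjoint a) b) w U ↔
      ∀ t ∈ Icc (0 : ℝ) T,
        w t = κ * U t + ∫ τ in (0 : ℝ)..t, inner ℂ a (S.orbit b (t - τ)) * U τ := by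
  refine forall₂_congr fun t ht => ?_
  have : ∫ τ in (0 : ℝ)..t, inner ℂ ((S.op (t - τ)).adjoint a) b * U τ =
      ∫ τ in (0 : ℝ)..t, inner ℂ a (S.orbit b (t - τ)) * U τ := by
    refine intervalIntegral.integral_congr fun τ hτ => ?_
    rw [uIcc_of_le ht.1] at hτ
    rw [ContinuousLinearMap.adjoint_inner_left, S.orbit_of_nonneg b (sub_nonneg.2 hτ.2)]
  rw [this]

/-- Every absolutely continuous signal with square integrable derivative and the correct initial
value is the output for a unique square integrable control, which is obtained from a Volterra
equation of the second kind. -/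
theorem exists_control_of_output (hS : S.HasGenerator A) {c : X} (hc : c ∈ A.adjoint.domain)
    {b : X} (hcb : inner ℂ c b ≠ 0) (x : X) {T : ℝ} (hT : 0 ≤ T) {β : ℂ} {v : ℝ → ℂ}
    (hv : MemH1 T (inner ℂ c x) β v) :
    ∃ U u : ℝ → ℂ,
      SolvesVolterra T (inner ℂ c b)
        (fun s => inner ℂ ((S.op s).adjoint (A.adjoint ⟨c, hc⟩)) b)
        (fun t => v t - inner ℂ c (S.op t x)) U ∧
      (∀ U' : ℝ → ℂ, ContinuousOn U' (Icc 0 T) →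
        SolvesVolterra T (inner ℂ c b)
          (fun s => inner ℂ ((S.op s).adjoint (A.adjoint ⟨c, hc⟩)) b)
          (fun t => v t - inner ℂ c (S.op t x)) U' → EqOn U' U (Icc 0 T)) ∧
      AbsolutelyContinuousOnInterval U 0 T ∧ U 0 = 0 ∧
      (∀ᵐ t ∂(volIcc T), HasDerivAt U (u t) t) ∧ MemLp u 2 (volIcc T) ∧
      ∀ t ∈ Icc (0 : ℝ) T, outputSignal S b c x u t = v t := by
  have hk := S.continuous_inner_orbit (A.adjoint ⟨c, hc⟩) b
  have hkx := S.continuous_inner_orbit (A.adjoint ⟨c, hc⟩) x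
  have hvi := intervalIntegrable_of_memLp_volIcc hT hv.deriv_memLp
  -- The initial value `v 0 = (c, x)` cancels, so the right-hand side is the primitive of an `L²`
  -- function; this yields `U 0 = 0` and `U' ∈ L²`.
  have hw : ∀ t ∈ Icc 0 T, v t - inner ℂ c (S.op t x) =
      ∫ s in (0 : ℝ)..t, (deriv v s - inner ℂ (A.adjoint ⟨c, hc⟩) (S.orbit x s)) := fun t ht => by
    rw [intervalIntegral.integral_sub (hvi.zero_left_of_mem ht) (hkx.intervalIntegrable _ _),
      hv.eq_add_integral hT t ht, C0Semigroup.inner_op_eq_add_integral hS hc x ht.1]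
    ring
  obtain ⟨u, hu, hU⟩ := exists_memLp_volterra
    (k := fun s => inner ℂ (A.adjoint ⟨c, hc⟩) (S.orbit b s)) hT hcb hk
    (hv.deriv_memLp.sub hkx.continuousOn.memLp_volIcc)
  have hui := intervalIntegrable_of_memLp_volIcc hT hu
  have hAC := absolutelyContinuousOnInterval_primitive hT hui 0
  have hder := ae_hasDerivAt_primitive hui 0
  have hUc := continuousOn_primitive_Icc hT hui 0
  simp only [zero_add] at hAC hder hUc
  have hsol : ∀ t ∈ Icc (0 : ℝ) T, v t - inner ℂ c (S.op t x) =
      inner ℂ c b * (∫ s in (0 : ℝ)..t, u s) +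
        ∫ τ in (0 : ℝ)..t, inner ℂ (A.adjoint ⟨c, hc⟩) (S.orbit b (t - τ)) *
          ∫ s in (0 : ℝ)..τ, u s := fun t ht => (hw t ht).trans (hU t ht).symm
  refine ⟨fun t => ∫ s in (0 : ℝ)..t, u s, u, (solvesVolterra_adjoint_iff S _ b).2 hsol, ?_, hAC,
    by simp, ?_, hu, fun t ht => ?_⟩
  · intro U' hU' hsol' t ht
    rw [solvesVolterra_adjoint_iff] at hsol'
    refine sub_eq_zero.1 (eqOn_zero_of_volterra
      (f := fun t => U' t - ∫ s in (0 : ℝ)..t, u s) hcb hk (hU'.sub hUc) (fun t ht => ?_) t ht)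
    have hi : ∀ {f : ℝ → ℂ}, ContinuousOn f (Icc 0 T) → IntervalIntegrable
        (fun τ => inner ℂ (A.adjoint ⟨c, hc⟩) (S.orbit b (t - τ)) * f τ) volume 0 t := fun hf => by
      refine ContinuousOn.intervalIntegrable ?_
      rw [uIcc_of_le ht.1]
      exact (hk.comp (by fun_prop : Continuous fun τ : ℝ => t - τ)).continuousOn.mul
        (hf.mono (Icc_subset_Icc_right ht.2))
    simp only [mul_sub]
    rw [intervalIntegral.integral_sub (hi hU') (hi hUc)]
    linear_combination hsol t ht - hsol' t ht
  · rw [ae_restrict_iff' measurableSet_Icc]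
    filter_upwards [hder] with t ht htT
    exact ht (by rwa [uIcc_of_le hT])
  · rw [outputSignal_eq hS hc b x ht.1 (hui.zero_left_of_mem ht), ← hsol t ht]
    ring

end Output

theorem mildSolution_congr {X : Type*} [NormedAddCommGroup X] [NormedSpace ℂ X]
    (S : C0Semigroup X) (b x : X) {v w : ℝ → ℂ} {t : ℝ} (ht : 0 ≤ t) (h : EqOn v w (Icc 0 t)) :
    mildSolution S b x v t = mildSolution S b x w t := by
  rw [mildSolution, mildSolution]
  congr 1
  refine intervalIntegral.integral_congr fun τ hτ => ?_
  rw [uIcc_of_le ht] at hτ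
  rw [h hτ]

theorem theorem3p2
    {X₁ X₂ : Type*}
    [NormedAddCommGroup X₁] [InnerProductSpace ℂ X₁] [CompleteSpace X₁]
    [TopologicalSpace.SeparableSpace X₁]
    [NormedAddCommGroup X₂] [InnerProductSpace ℂ X₂] [CompleteSpace X₂]
    [TopologicalSpace.SeparableSpace X₂]
    -- the two generators and their semigroups
    (A₁ : X₁ →ₗ.[ℂ] X₁) (S₁ : C0Semigroup X₁) (hS₁ : S₁.HasGenerator A₁)
    (A₂ : X₂ →ₗ.[ℂ] X₂) (S₂ : C0Semigroup X₂) (hS₂ : S₂.HasGenerator A₂)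
    (b₁ : X₁) (b₂ c : X₂) (t₁ : ℝ) (ht₁ : 0 < t₁)
    -- eigenvalues of A₁ (distinct, without finite limit point), eigenvectors of A₁ forming
    -- a Riesz basis, and the biorthogonal eigenvectors of the adjoint
    {J : Type*} (lam : J → ℂ) (φ ψ : J → X₁)
    (hlam_inj : Function.Injective lam)
    (hlam_fin : ∀ R : ℝ, {j : J | ‖lam j‖ ≤ R}.Finite)
    (hφ : ∀ j, (φ j, lam j • φ j) ∈ A₁.graph)
    (hφ_basis : IsRieszBasis φ)
    (hψ : ∀ j, (ψ j, (starRingEnd ℂ) (lam j) • ψ j) ∈ A₁.adjoint.graph)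
    (hψ_self : ∀ j, inner ℂ (ψ j) (φ j) = 1)
    (hψ_ne : ∀ i j, i ≠ j → inner ℂ (ψ i) (φ j) = 0)
    -- if 0 is an eigenvalue, the corresponding coefficient of b₁ is nonzero
    (hzero : ∀ j, lam j = 0 → inner ℂ (ψ j) b₁ ≠ 0)
    (hmin : StronglyMinimal (augmentedExponentials t₁ lam (fun j => inner ℂ (ψ j) b₁)))
    (hc : c ∈ A₂.adjoint.domain) (hcb : inner ℂ c b₂ ≠ 0) :
    ExactlyNullControllable S₁ b₁ S₂ b₂ c t₁ ∧
    ∀ (x10 : X₁) (x20 : X₂),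
      (∃ v : ℝ → ℂ, MemH1 t₁ (inner ℂ c x20) 0 v ∧ mildSolution S₁ b₁ x10 v t₁ = 0) ∧
      ∀ v : ℝ → ℂ, MemH1 t₁ (inner ℂ c x20) 0 v → mildSolution S₁ b₁ x10 v t₁ = 0 →
        ∃ U u : ℝ → ℂ,
          -- U is the unique continuous solution of the Volterra equation
          SolvesVolterra t₁ (inner ℂ c b₂)
            (fun s => inner ℂ ((S₂.op s).adjoint (A₂.adjoint ⟨c, hc⟩)) b₂)
            (fun t => v t - inner ℂ c (S₂.op t x20)) U ∧
          (∀ U' : ℝ → ℂ, ContinuousOn U' (Icc 0 t₁) →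
            SolvesVolterra t₁ (inner ℂ c b₂)
              (fun s => inner ℂ ((S₂.op s).adjoint (A₂.adjoint ⟨c, hc⟩)) b₂)
              (fun t => v t - inner ℂ c (S₂.op t x20)) U' → EqOn U' U (Icc 0 t₁)) ∧
          AbsolutelyContinuousOnInterval U 0 t₁ ∧ U 0 = 0 ∧
          -- its derivative u is a square integrable control producing the output v
          (∀ᵐ t ∂(volIcc t₁), HasDerivAt U (u t) t) ∧ MemLp u 2 (volIcc t₁) ∧
          (∀ t ∈ Icc (0 : ℝ) t₁, outputSignal S₂ b₂ c x20 u t = v t) ∧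
          mildSolution S₁ b₁ x10 (outputSignal S₂ b₂ c x20 u) t₁ = 0 := by
  have hex := fun (x : X₁) (α : ℂ) => exists_memH1_mildSolution_eq_zero hS₁ ht₁.le hlam_inj
    hlam_fin hφ hφ_basis hψ_self hψ_ne hzero hmin x α
  refine ⟨fun x10 x20 => ?_, fun x10 x20 => ⟨hex x10 _, fun v hv hv0 => ?_⟩⟩
  · obtain ⟨v, hv, hv0⟩ := hex x10 (inner ℂ c x20)
    obtain ⟨U, u, -, -, -, -, -, hu, hout⟩ := exists_control_of_output hS₂ hc hcb x20 ht₁.le hv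
    exact ⟨u, hu, (mildSolution_congr S₁ b₁ x10 ht₁.le hout).trans hv0⟩
  · obtain ⟨U, u, h1, h2, h3, h4, h5, hu, hout⟩ :=
      exists_control_of_output hS₂ hc hcb x20 ht₁.le hv
    exact ⟨U, u, h1, h2, h3, h4, h5, hu, hout,
      (mildSolution_congr S₁ b₁ x10 ht₁.le hout).trans hv0⟩
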